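/- **Definitions.** For an integer partition $\gamma=(\gamma_1\ge\gamma_2\ge\cdots)$ let $|\gamma|$ be its size and $\ell(\gamma)$ its number of positive parts, and put $\gamma_i=0$ for $i>\ell(\gamma)$. The notation $i^c$ means $c$ copies of $i$. *Quasi-Dyck vectors.* A quasi-Dyck vector is an integer sequence $v_1v_2\cdots v_n$ ($n\ge 1$) with $v_1=0$ and $v_{i+1}\le v_i+1$ for $1\le i<n$. For a partition $\gamma$ and $n>\ell(\gamma)$, the sequence $Q_n(\gamma)=(0-\gamma_n,\,1-\gamma_{n-1},\,\ldots,\,(n-1)-\gamma_1)$ is a quasi-Dyck vector, and every quasi-Dyck vector $v$ equals $Q_n(\gamma)$ for exactly one partition $\gamma$ (with $n$ the length of $v$); this partition is denoted $[v]$. Let $\min_\Delta(\gamma)$ be the least $n>\ell(\gamma)$ such that all entries of $Q_n(\gamma)$ are nonnegative (equivalently, the Ferrers diagram of $\gamma$ fits inside that of $(n-1,n-2,\ldots,1,0)$). *The map $\mathrm{ND}$.* This is the partial map on partitions given by the following rules (at most one of which applies to a given partition). 1. If $\gamma$ is nonzero and $\gamma_1\ge\ell=\ell(\gamma)$, then $\mathrm{ND}(\gamma)=(\gamma_2+1,\gamma_3+1,\ldots,\gamma_\ell+1,1^{\gamma_1-\ell})$.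 2. $\mathrm{ND}([0^h1A1^h])=[012^hA(-1)^{h-1}]$ whenever $h\ge2$ and $A=A_1\cdots A_s$ is a list of integers that is empty or satisfies $A_i\le 2$ for all $i$, $A_s\ge0$, and $A_{i+1}\le A_i+1$ for all $i<s$. 3. $\mathrm{ND}([0^{k+1}B01^k])=[012^kB(-1)^k]$ whenever $k\ge1$ and $B=B_1\cdots B_s$ is a list of integers that is empty or satisfies $B_i\le 2$ for all $i$, $B_1\le1$, $B_s\ge-1$, and $B_{i+1}\le B_i+1$ for all $i<s$. *Tail initiators.* For a partition $\mu$ having $n_i$ parts equal to $i$ and largest part $r=\mu_1$, let $B_\mu=01^{n_1}01^{n_2}\cdots01^{n_r}$ (empty if $\mu$ is the zero partition), and let $\mathrm{TI}(\mu)=[0B_\mu]$. Let $\mathrm{TI}_2(\mu)$ be the partition obtained by starting at $\mathrm{TI}(\mu)$ and applying $\mathrm{ND}$ as many times as possible (this process always stops). A partition $\mu$ is a *flagpole partition* if $|\mu|+8\le 2\min_\Delta(\mathrm{TI}_2(\mu))$. **Theorem.** For every integer $n\ge0$, the number of flagpole partitions of size $n$ is $$\sum_{j=0}^{\lfloor (n-4)/2\rfloor}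 2\,p(j),$$ where $p(j)$ is the number of integer partitions of size $j$ (so the sum is empty, with value $0$, when $n<4$). -/

import Mathlib

namespace Flagpole

/-- An integer partition (of any size). -/
abbrev IntPartition : Type := Σ n : ℕ, n.Partition

namespace IntPartition

/-- The size `|γ|`, the sum of the parts. -/
def size (γ : IntPartition) : ℕ := γ.1

/-- The number `ℓ(γ)` of positive parts. -/
def length (γ : IntPartition) : ℕ := γ.2.parts.card

/-- The list of positive parts in weakly decreasing order. -/
def sortedParts (γ : IntPartition) : List ℕ := γ.2.parts.sort (· ≥ ·)

/-- `γ.part k` is the part `γ_{k+1}` (indices start at `0` here), with `γ_i = 0` for `i > ℓ(γ)`. -/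
def part (γ : IntPartition) (k : ℕ) : ℕ := γ.sortedParts.getD k 0

/-- The partition whose parts are the nonzero members of the given list. -/
def ofParts (l : List ℕ) : IntPartition := ⟨_, Nat.Partition.ofMultiset (l : Multiset ℕ)⟩

end IntPartition

open IntPartition

/-! ### Quasi-Dyck vectors -/

/-- Consecutive entries increase by at most `1`. -/
def SlowlyIncreasing (v : List ℤ) : Prop := v.IsChain (fun a b => b ≤ a + 1)

/-- Quasi-Dyck vectors: the first entry is `0`, and `v_{i+1} ≤ v_i + 1`. -/
def IsQDV (v : List ℤ) : Prop := v.head? = some 0 ∧ SlowlyIncreasing v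

/-- The vector of length `n` attached to a partition `γ`, namely
`(0 - γ_n, 1 - γ_{n-1}, …, (n-1) - γ_1)`. For `n > ℓ(γ)` it is a quasi-Dyck vector, and the
vectors for all such `n` form the Dyck class that is identified with `γ`. -/
def qdv (n : ℕ) (γ : IntPartition) : List ℤ :=
  (List.range n).map fun i : ℕ => (i : ℤ) - (γ.part (n - 1 - i) : ℤ)

/-- The partition `[v]` identified with the Dyck class of the quasi-Dyck vector `v_1 ⋯ v_n`: its
parts are the positive ones among `n - 1 - v_n, …, 1 - v_2, 0 - v_1`. -/
def ofQDV (v : List ℤ) : IntPartition :=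
  ofParts (v.zipIdx.map fun p => ((p.2 : ℤ) - p.1).toNat)

theorem getD_filter_aux (L : List ℕ) (h : L.Pairwise (· ≥ ·)) (k : ℕ) :
    (L.filter (· ≠ 0)).getD k 0 = L.getD k 0 := by
  induction L generalizing k with
  | nil => simp
  | cons a L ih =>
    rw [List.pairwise_cons] at h
    by_cases ha : a = 0
    · have h0 : ∀ x ∈ a :: L, x = 0 := by
        intro x hx
        rcases List.mem_cons.1 hx with rfl | hx
        · exact ha
        · have := h.1 x hx; omega
      have h1 : (a :: L).filter (· ≠ 0) = [] := by
        rw [List.filter_eq_nil_iff]; intro x hx; simp [h0 x hx]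
      rw [h1, List.getD_eq_getElem?_getD, List.getD_eq_getElem?_getD]
      rcases hk : (a :: L)[k]? with _ | x
      · simp
      · have := h0 x (List.mem_of_getElem? hk); simp [this]
    · rw [List.filter_cons_of_pos (by simpa using ha)]
      cases k with
      | zero => simp
      | succ k => simpa using ih h.2 k

theorem ofParts_part (L : List ℕ) (h : L.Pairwise (· ≥ ·)) (k : ℕ) :
    (ofParts L).part k = L.getD k 0 := by
  have : (ofParts L).sortedParts = L.filter (· ≠ 0) := by
    unfold sortedParts ofParts
    simp only [Nat.Partition.ofMultiset_parts, Multiset.filter_coe, Multiset.coe_sort]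
    apply List.mergeSort_of_pairwise
    simpa using h.filter _
  rw [part, this, getD_filter_aux L h]

theorem ofParts_reverse (L : List ℕ) : ofParts L.reverse = ofParts L := by
  unfold ofParts; rw [Multiset.coe_reverse]

/-- `[v]` is the partition whose Dyck class contains `v`. -/
theorem qdv_ofQDV (v : List ℤ) (hv : IsQDV v) :
    (ofQDV v).length < v.length ∧ qdv v.length (ofQDV v) = v := by
  obtain ⟨h0, hc⟩ := hv
  have hstep : ∀ i (hi : i + 1 < v.length), v[i+1] ≤ v[i] + 1 :=
    fun i hi => List.isChain_iff_getElem.1 hc i hi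
  have h00 : ∀ (h : 0 < v.length), v[0] = 0 := by
    cases v with
    | nil => simp
    | cons a l => simpa using h0
  have hpos : 0 < v.length := by cases v <;> simp_all
  have hle : ∀ i (hi : i < v.length), v[i] ≤ i := by
    intro i
    induction i with
    | zero => intro hi; simp [h00]
    | succ i ih => intro hi; have := ih (by omega); have := hstep i hi; push_cast; omega
  set P := v.zipIdx.map fun p => ((p.2 : ℤ) - p.1).toNat with hP
  have hlen : P.length = v.length := by simp [hP]
  have hget : ∀ i (hi : i < P.length), P[i] = ((i : ℤ) - v[i]'(hlen ▸ hi)).toNat := by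
    intro i hi; simp [hP]
  have hsort : P.reverse.Pairwise (· ≥ ·) := by
    rw [List.pairwise_reverse]
    have : P.IsChain (fun a b => b ≥ a) := by
      rw [List.isChain_iff_getElem]
      intro i hi
      rw [hget, hget]
      have := hstep i (by omega)
      push_cast; omega
    exact List.isChain_iff_pairwise.1 this
  have hQ : ofQDV v = ofParts P.reverse := by rw [ofParts_reverse]; rfl
  refine ⟨?_, ?_⟩
  · have : (ofQDV v).length = (P.filter (· ≠ 0)).length := by
      simp [ofQDV, length, ofParts, ← hP]
    rw [this, ← hlen]
    apply List.length_filter_lt_length_iff_exists.2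
    refine ⟨P[0]'(by omega), List.getElem_mem _, ?_⟩
    rw [hget]; simp [h00]
  · apply List.ext_getElem
    · simp [qdv]
    · intro i h1 h2
      simp only [qdv, List.getElem_map, List.getElem_range, hQ]
      rw [ofParts_part _ hsort, List.getD_eq_getElem _ _ (by simp; omega), List.getElem_reverse, hget]
      have e : P.length - 1 - (v.length - 1 - i) = i := by omega
      simp only [e]
      have := hle i h2
      omega

/-- The minimum triangle height: the least `n > ℓ(γ)` such that the diagram of `γ` fits into that of
`(n-1, n-2, …, 1, 0)`, that is, such that the vector of length `n` has no negative entry. -/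
noncomputable def minTri (γ : IntPartition) : ℕ :=
  sInf {n : ℕ | γ.length < n ∧ ∀ x ∈ qdv n γ, 0 ≤ x}

/-! ### The extended next-down map -/

/-- `NextDown1 γ δ` means that the map `ND₁` is defined at `γ` and sends it to `δ`: it is defined at
the nonzero partitions with `γ_1 ≥ ℓ(γ)`, where `δ = (γ_2 + 1, …, γ_ℓ + 1, 1^{γ_1 - ℓ})`. (The zero
partition is not in the image of `NU₁`, so `ND₁` is undefined there.) -/
def NextDown1 (γ δ : IntPartition) : Prop :=
  0 < γ.length ∧ γ.length ≤ γ.part 0 ∧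
    δ = ofParts (γ.sortedParts.tail.map (· + 1) ++ List.replicate (γ.part 0 - γ.length) 1)

/-- `NextUp2 δ γ` means that the map `NU₂` is defined at `δ` and sends it to `γ`.
First rule: `[0 1 2^h A (-1)^{h-1}] ↦ [0^h 1 A 1^h]`.
Second rule: `[0 1 2^k B (-1)^k] ↦ [0^{k+1} B 0 1^k]`. -/
def NextUp2 (δ γ : IntPartition) : Prop :=
  (∃ (h : ℕ) (A : List ℤ), 2 ≤ h ∧ SlowlyIncreasing A ∧ (∀ x ∈ A, x ≤ 2) ∧
      (∀ x ∈ A.getLast?, 0 ≤ x) ∧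
      δ = ofQDV ([0, 1] ++ List.replicate h 2 ++ A ++ List.replicate (h - 1) (-1)) ∧
      γ = ofQDV (List.replicate h 0 ++ [1] ++ A ++ List.replicate h 1)) ∨
  (∃ (k : ℕ) (B : List ℤ), 1 ≤ k ∧ SlowlyIncreasing B ∧ (∀ x ∈ B, x ≤ 2) ∧
      (∀ x ∈ B.head?, x ≤ 1) ∧ (∀ x ∈ B.getLast?, -1 ≤ x) ∧
      δ = ofQDV ([0, 1] ++ List.replicate k 2 ++ B ++ List.replicate k (-1)) ∧
      γ = ofQDV (List.replicate (k + 1) 0 ++ B ++ [0] ++ List.replicate k 1))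

/-- `NextDown γ δ` means that the extended next-down map `ND` (which is `ND₁` together with the
inverse of `NU₂`) is defined at `γ` and sends it to `δ`. -/
def NextDown (γ δ : IntPartition) : Prop := NextDown1 γ δ ∨ NextUp2 δ γ

/-! ### Tail initiators and flagpole partitions -/

/-- The binary word `B_μ = 0 1^{n_1} 0 1^{n_2} ⋯ 0 1^{n_r}`, where `r = μ_1` and `n_i` is the number
of parts equal to `i`; it is empty for the zero partition. -/
def binWord (μ : IntPartition) : List ℤ :=
  (List.range (μ.part 0)).flatMap fun i => 0 :: List.replicate (μ.2.parts.count (i + 1)) 1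

/-- The tail initiator `TI(μ) = [0 B_μ]`. -/
def tailInit (μ : IntPartition) : IntPartition := ofQDV (0 :: binWord μ)

/-- `γ` is the second-order tail initiator `TI₂(μ)`: the partition reached by starting at `TI(μ)` and
applying `ND` as many times as possible. -/
def IsTailInit2 (μ γ : IntPartition) : Prop :=
  Relation.ReflTransGen NextDown (tailInit μ) γ ∧ ∀ δ, ¬ NextDown γ δ

/-- Flagpole partitions: `|μ| + 8 ≤ 2 · minTri (TI₂(μ))`. -/
def IsFlagpole (μ : IntPartition) : Prop :=
  ∃ γ, IsTailInit2 μ γ ∧ μ.size + 8 ≤ 2 * minTri γ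

end Flagpole

/-! Partitions are handled through words. Two vectors of one class differ by iterating `up` (prepend
0, raise every entry by 1), so a representative that starts with 0 0, or one with a prescribed last
entry, is unique. This turns statements about ND into statements about words: ND₁ is the rotation [0
w 0] ↦ [0 1 w], and comparing runs of equal letters shows that ND is both single-valued and
injective (`nextDown_right_unique`, `nextDown_left_unique`).

The deficit of a nonnegative representative is the number of pairs i < j with v_i - v_j not in {0,
1}, minus the sum of the entries. It equals |μ| at TI(μ) and is constant along the orbit. To prove
this, the orbit is followed by words with entries in {-1, 0, 1, 2} (`Tame`), a class that ND
preserves as long as the deficit is positive (`Reach.nextDown1`, `Reach.nextUp2`).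

A terminal tame word is strongly restricted at both ends, since otherwise a rule would apply. For a
nonnegative word with a second 0, min_Δ is the length. Lower bounds for the deficit then show that
the flagpole inequality leaves only 0 0 1 2^a 1 2^{n_1} ⋯ 1 2^{n_r} 1^k with k ≤ 1
(`terminal_form`). Reading n_i as the multiplicities of a partition ν gives deficit + 2 = length +
|ν| (`defc_blockVec`). Hence min_Δ = n + 2 - |ν|, the inequality becomes 2|ν| + 4 ≤ n, and a is
determined by n, ν and k.

Conversely, each of these words is terminal (`not_nextDown_terminal`) and is reached from some tail
initiator, found by stepping backwards (`exists_reflTransGen_blockVec`). That tail initiator is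
unique: by injectivity, two with a common descendant lie on one orbit, and everything strictly
before a tail initiator lies in the domain of ND₁, which contains no TI(μ) with |μ| > 0
(`eq_of_reflTransGen_tailInit`). So flagpole partitions of size n correspond to pairs (ν, k), that
is, 2 p(j) of them for every j with 2j + 4 ≤ n. -/

namespace Flagpole
open IntPartition Relation

/-! ### Parts of a partition and extensionality -/

namespace IntPartition

theorem sortedParts_pairwise (γ : IntPartition) : γ.sortedParts.Pairwise (· ≥ ·) :=
  Multiset.pairwise_sort _ _

theorem length_sortedParts (γ : IntPartition) : γ.sortedParts.length = γ.length := by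
  simp [sortedParts, length]

theorem pos_of_mem_sortedParts {γ : IntPartition} {x : ℕ} (h : x ∈ γ.sortedParts) : 0 < x :=
  γ.2.parts_pos (by simpa [sortedParts] using h)

theorem part_eq_getElem (γ : IntPartition) {k : ℕ} (h : k < γ.sortedParts.length) :
    γ.part k = γ.sortedParts[k] := by
  simp [part, h]

theorem part_eq_zero_iff (γ : IntPartition) (k : ℕ) : γ.part k = 0 ↔ γ.length ≤ k := by
  rw [← length_sortedParts]
  rcases lt_or_ge k γ.sortedParts.length with h | h
  · rw [part_eq_getElem γ h]
    have := pos_of_mem_sortedParts (List.getElem_mem h)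
    omega
  · simp [part, h]

theorem part_antitone (γ : IntPartition) : Antitone γ.part := by
  intro i j hij
  rcases lt_or_ge j γ.sortedParts.length with h | h
  · rw [part_eq_getElem γ h, part_eq_getElem γ (hij.trans_lt h)]
    rcases hij.eq_or_lt with rfl | hlt
    · exact le_rfl
    · exact List.pairwise_iff_getElem.1 γ.sortedParts_pairwise i j _ h hlt
  · rw [(part_eq_zero_iff γ j).2 (by rwa [← length_sortedParts])]
    exact Nat.zero_le _

theorem length_eq_of_part_eq {γ δ : IntPartition} (h : ∀ k, γ.part k = δ.part k) :
    γ.length = δ.length := by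
  have key : ∀ k, γ.length ≤ k ↔ δ.length ≤ k := fun k => by
    rw [← part_eq_zero_iff, ← part_eq_zero_iff, h]
  exact le_antisymm ((key _).2 le_rfl) ((key _).1 le_rfl)

theorem ext_parts {γ δ : IntPartition} (h : γ.2.parts = δ.2.parts) : γ = δ := by
  obtain ⟨n, p⟩ := γ
  obtain ⟨m, q⟩ := δ
  have hnm : n = m := by rw [← p.parts_sum, ← q.parts_sum]; exact congrArg _ h
  subst hnm
  congr 1
  exact Nat.Partition.ext h

theorem ext_part {γ δ : IntPartition} (h : ∀ k, γ.part k = δ.part k) : γ = δ := by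
  have hl := length_eq_of_part_eq h
  have hs : γ.sortedParts = δ.sortedParts := by
    apply List.ext_getElem
    · rw [length_sortedParts, length_sortedParts, hl]
    · intro i h1 h2
      rw [← part_eq_getElem, ← part_eq_getElem, h]
  apply ext_parts
  have := congrArg (fun l : List ℕ => (l : Multiset ℕ)) hs
  simpa [sortedParts] using this

end IntPartition

/-! ### Vectors representing a partition -/

@[simp] theorem length_qdv (n : ℕ) (γ : IntPartition) : (qdv n γ).length = n := by simp [qdv]

theorem getElem_qdv (n : ℕ) (γ : IntPartition) (i : ℕ) (h : i < (qdv n γ).length) :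
    (qdv n γ)[i] = (i : ℤ) - γ.part (n - 1 - i) := by simp [qdv]

theorem isQDV_cons {a : ℤ} {x : List ℤ} :
    IsQDV (a :: x) ↔ a = 0 ∧ SlowlyIncreasing (a :: x) := by simp [IsQDV]

theorem isQDV_qdv {n : ℕ} {γ : IntPartition} (h : γ.length < n) : IsQDV (qdv n γ) := by
  constructor
  · have h0 : 0 < (qdv n γ).length := by simp; omega
    rw [List.head?_eq_getElem?, List.getElem?_eq_getElem h0, getElem_qdv,
      (part_eq_zero_iff _ _).2 (by omega)]
    simp
  · refine List.isChain_iff_getElem.2 fun i hi => ?_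
    rw [getElem_qdv, getElem_qdv]
    have := γ.part_antitone (show n - 1 - (i + 1) ≤ n - 1 - i by omega)
    push_cast
    have : (γ.part (n - 1 - i) : ℤ) ≤ γ.part (n - 1 - (i + 1)) := by exact_mod_cast this
    linarith

theorem eq_of_qdv_eq {n : ℕ} {γ δ : IntPartition} (hγ : γ.length < n) (hδ : δ.length < n)
    (h : qdv n γ = qdv n δ) : γ = δ := by
  refine ext_part fun k => ?_
  rcases lt_or_ge k n with hk | hk
  · have h1 : n - 1 - k < (qdv n γ).length := by simp; omega
    have h2 : n - 1 - k < (qdv n δ).length := by simp; omega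
    have e : (qdv n γ)[n - 1 - k] = (qdv n δ)[n - 1 - k] := by simp [h]
    rw [getElem_qdv, getElem_qdv, show n - 1 - (n - 1 - k) = k by omega] at e
    have : (γ.part k : ℤ) = δ.part k := by linarith
    exact_mod_cast this
  · rw [(part_eq_zero_iff _ _).2 (by omega), (part_eq_zero_iff _ _).2 (by omega)]

theorem ofQDV_eq_iff {v : List ℤ} (hv : IsQDV v) {γ : IntPartition} :
    ofQDV v = γ ↔ γ.length < v.length ∧ qdv v.length γ = v := by
  constructor
  · rintro rfl
    exact qdv_ofQDV v hv
  · rintro ⟨h1, h2⟩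
    exact eq_of_qdv_eq (qdv_ofQDV v hv).1 h1 ((qdv_ofQDV v hv).2.trans h2.symm)

theorem ofQDV_qdv {n : ℕ} {γ : IntPartition} (h : γ.length < n) : ofQDV (qdv n γ) = γ :=
  (ofQDV_eq_iff (isQDV_qdv h)).2 (by simpa using h)

theorem qdv_succ {n : ℕ} {γ : IntPartition} (h : γ.length ≤ n) :
    qdv (n + 1) γ = 0 :: (qdv n γ).map (· + 1) := by
  apply List.ext_getElem
  · simp
  · intro i h1 h2
    rw [getElem_qdv]
    cases i with
    | zero => simp [(part_eq_zero_iff γ n).2 h]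
    | succ i =>
      simp only [List.getElem_cons_succ, List.getElem_map, getElem_qdv]
      rw [show n + 1 - 1 - (i + 1) = n - 1 - i by omega]
      push_cast; ring

/-- The representative of the same partition that is one entry longer. -/
def up (v : List ℤ) : List ℤ := 0 :: v.map (· + 1)

@[simp] theorem length_up (v : List ℤ) : (up v).length = v.length + 1 := by simp [up]

theorem slow_map_add {v : List ℤ} (c : ℤ) :
    SlowlyIncreasing (v.map (· + c)) ↔ SlowlyIncreasing v := by
  rw [SlowlyIncreasing, SlowlyIncreasing, List.isChain_map]
  constructor <;> intro h <;> refine h.imp fun a b hab => ?_ <;> linarith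

theorem IsQDV.up {v : List ℤ} (hv : IsQDV v) : IsQDV (up v) := by
  cases v with
  | nil => simp [IsQDV] at hv
  | cons a x =>
    obtain ⟨rfl, hs⟩ := isQDV_cons.1 hv
    have := (slow_map_add 1).2 hs
    simpa [Flagpole.up, IsQDV, SlowlyIncreasing] using this

theorem ofQDV_up {v : List ℤ} (hv : IsQDV v) : ofQDV (up v) = ofQDV v := by
  obtain ⟨h1, h2⟩ := qdv_ofQDV v hv
  refine (ofQDV_eq_iff hv.up).2 ⟨by simp; omega, ?_⟩
  rw [length_up, qdv_succ h1.le, h2, up]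

theorem IsQDV.iterate_up {v : List ℤ} (hv : IsQDV v) (k : ℕ) : IsQDV (Flagpole.up^[k] v) := by
  induction k with
  | zero => exact hv
  | succ k ih => rw [Function.iterate_succ_apply']; exact ih.up

theorem eq_of_ofQDV_eq {v w : List ℤ} (hv : IsQDV v) (hw : IsQDV w) (h : ofQDV v = ofQDV w)
    (hl : v.length = w.length) : v = w := by
  rw [← (qdv_ofQDV v hv).2, ← (qdv_ofQDV w hw).2, h, hl]

theorem exists_iterate_up {v w : List ℤ} (hv : IsQDV v) (hw : IsQDV w) (h : ofQDV v = ofQDV w)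
    (hl : v.length ≤ w.length) : ∃ k, w = up^[k] v := by
  obtain ⟨k, hk⟩ := Nat.exists_eq_add_of_le hl
  have hlen : ∀ k, (up^[k] v).length = v.length + k := by
    intro k
    induction k with
    | zero => simp
    | succ k ih => rw [Function.iterate_succ_apply', length_up, ih]; omega
  have hcl : ∀ k, ofQDV (up^[k] v) = ofQDV v := by
    intro k
    induction k with
    | zero => simp
    | succ k ih => rw [Function.iterate_succ_apply', ofQDV_up (hv.iterate_up k), ih]
  exact ⟨k, eq_of_ofQDV_eq hw (hv.iterate_up k) ((hcl k).trans h).symm (by rw [hlen, hk])⟩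

theorem iterate_up_of_ofQDV_eq {v w : List ℤ} (hv : IsQDV v) (hw : IsQDV w)
    (h : ofQDV v = ofQDV w) : ∃ k, w = up^[k] v ∨ v = up^[k] w := by
  rcases le_total v.length w.length with hl | hl
  · obtain ⟨k, hk⟩ := exists_iterate_up hv hw h hl
    exact ⟨k, .inl hk⟩
  · obtain ⟨k, hk⟩ := exists_iterate_up hw hv h.symm hl
    exact ⟨k, .inr hk⟩

theorem getLast?_iterate_up {v : List ℤ} {a : ℤ} (h : v.getLast? = some a) (k : ℕ) :
    (up^[k] v).getLast? = some (a + k) := by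
  induction k with
  | zero => simpa using h
  | succ k ih =>
    rw [Function.iterate_succ_apply', up, List.getLast?_cons, List.getLast?_map, ih]
    simp; ring

theorem iterate_up_succ_eq (v : List ℤ) (hv : IsQDV v) (k : ℕ) :
    ∃ x, up^[k + 1] v = 0 :: 1 :: x := by
  have := hv.iterate_up k
  rw [Function.iterate_succ_apply']
  cases h : up^[k] v with
  | nil => simp [h, IsQDV] at this
  | cons a y =>
    rw [h] at this
    obtain ⟨rfl, -⟩ := isQDV_cons.1 this
    exact ⟨y.map (· + 1), by simp [up]⟩

/-- A raised quasi-Dyck vector starts with 0 1, so a representative starting with 0 0 is the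
shortest of its class. -/
theorem eq_of_ofQDV_eq_of_start {v w : List ℤ} (hv : IsQDV (0 :: 0 :: v)) (hw : IsQDV (0 :: 0 :: w))
    (h : ofQDV (0 :: 0 :: v) = ofQDV (0 :: 0 :: w)) : v = w := by
  obtain ⟨k, hk⟩ := iterate_up_of_ofQDV_eq hv hw h
  cases k with
  | zero => rcases hk with hk | hk <;> simpa [eq_comm] using hk
  | succ k =>
    exfalso
    rcases hk with hk | hk
    · obtain ⟨x, hx⟩ := iterate_up_succ_eq _ hv k
      rw [hx] at hk; simp at hk
    · obtain ⟨x, hx⟩ := iterate_up_succ_eq _ hw k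
      rw [hx] at hk; simp at hk

/-- Raising increases the last entry by exactly 1, so that entry singles out the representative. -/
theorem eq_of_ofQDV_eq_of_getLast? {v w : List ℤ} {a : ℤ} (hv : IsQDV v) (hw : IsQDV w)
    (h : ofQDV v = ofQDV w) (hav : v.getLast? = some a) (haw : w.getLast? = some a) : v = w := by
  obtain ⟨k, hk⟩ := iterate_up_of_ofQDV_eq hv hw h
  rcases hk with hk | hk
  · have := getLast?_iterate_up hav k
    rw [← hk, haw] at this
    have : k = 0 := by simpa using this
    subst this; exact hk.symm
  · have := getLast?_iterate_up haw k
    rw [← hk, hav] at this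
    have : k = 0 := by simpa using this
    subst this; exact hk

/-! ### The map `ND₁` on vectors -/

theorem slow_cons_one {w : List ℤ} (h : SlowlyIncreasing (0 :: (w ++ [0]))) :
    SlowlyIncreasing (0 :: 1 :: w) := by
  unfold SlowlyIncreasing at h ⊢
  cases w with
  | nil => simp
  | cons a w =>
    simp only [List.cons_append, List.isChain_cons_cons] at h ⊢
    refine ⟨by norm_num, by linarith [h.1], ?_⟩
    rw [← List.cons_append] at h
    exact (List.isChain_append.1 h.2).1

/-- The representative of length γ₁ + 1 ends in 0, and it exists because γ₁ ≥ ℓ(γ). Removing the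
first part and adding 1 to the others moves the middle entries one place to the right without
changing their values. -/
theorem exists_nextDown1_rep {γ : IntPartition} (h0 : 0 < γ.length) (hl : γ.length ≤ γ.part 0) :
    ∃ w, SlowlyIncreasing (0 :: (w ++ [0])) ∧ γ = ofQDV (0 :: (w ++ [0])) ∧
      ofParts (γ.sortedParts.tail.map (· + 1) ++ List.replicate (γ.part 0 - γ.length) 1) =
        ofQDV (0 :: 1 :: w) := by
  set m := γ.part 0 with hm
  set w : List ℤ := (List.range (m - 1)).map fun i : ℕ => ((i : ℤ) + 1) - γ.part (m - 1 - i) with hw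
  have hv : qdv (m + 1) γ = 0 :: (w ++ [0]) := by
    apply List.ext_getElem
    · simp [hw]; omega
    · intro i h1 h2
      rw [getElem_qdv]
      simp only [length_qdv] at h1
      cases i with
      | zero => simp [(part_eq_zero_iff γ m).2 hl]
      | succ i =>
        simp only [List.getElem_cons_succ]
        rcases lt_or_ge i (m - 1) with h | h
        · rw [List.getElem_append_left (by simpa [hw] using h)]
          simp only [hw, List.getElem_map, List.getElem_range]
          rw [show m + 1 - 1 - (i + 1) = m - 1 - i by omega]
          push_cast; ring
        · rw [List.getElem_append_right (by simpa [hw] using h)]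
          have : i + 1 = m := by omega
          simp only [List.getElem_singleton]
          rw [show m + 1 - 1 - (i + 1) = 0 by omega, this, ← hm]; ring
  have hQ : IsQDV (0 :: (w ++ [0])) := hv ▸ isQDV_qdv (by omega)
  refine ⟨w, hQ.2, by rw [← hv, ofQDV_qdv (by omega)], ?_⟩
  have hQ' : IsQDV (0 :: 1 :: w) := by
    have := hQ.2
    simp only [isQDV_cons, true_and]
    exact slow_cons_one this
  set L := γ.sortedParts.tail.map (· + 1) ++ List.replicate (m - γ.length) 1 with hL
  have hLp : L.Pairwise (· ≥ ·) := by
    rw [hL, List.pairwise_append]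
    refine ⟨?_, by simp [List.pairwise_replicate], ?_⟩
    · rw [List.pairwise_map]
      exact γ.sortedParts_pairwise.tail.imp (by intro a b h; simpa using h)
    · intro a ha b hb
      obtain ⟨c, -, rfl⟩ := List.mem_map.1 ha
      rw [(List.mem_replicate.1 hb).2]
      exact Nat.le_add_left 1 c
  have hlen : L.length = m - 1 := by
    simp only [hL, List.length_append, List.length_map, List.length_tail, List.length_replicate,
      length_sortedParts]
    omega
  have hpart : ∀ k, k + 1 < m → (ofParts L).part k = γ.part (k + 1) + 1 := by
    intro k hk
    rw [ofParts_part L hLp, List.getD_eq_getElem _ _ (by omega)]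
    rcases lt_or_ge k (γ.length - 1) with h | h
    · rw [List.getElem_append_left (by simpa [length_sortedParts] using h)]
      rw [part_eq_getElem γ (by rw [length_sortedParts]; omega)]
      simp
    · rw [List.getElem_append_right (by simpa [length_sortedParts] using h)]
      rw [(part_eq_zero_iff γ _).2 (by omega)]
      simp
  have hpart0 : ∀ k, m ≤ k + 1 → (ofParts L).part k = 0 := by
    intro k hk
    rw [ofParts_part L hLp, List.getD_eq_default _ _ (by omega)]
  symm
  rw [ofQDV_eq_iff hQ']
  have hwl : w.length = m - 1 := by simp [hw]
  refine ⟨?_, ?_⟩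
  · have := (part_eq_zero_iff (ofParts L) (m - 1)).1 (hpart0 _ (by omega))
    simp only [List.length_cons]; omega
  · apply List.ext_getElem
    · simp
    · intro i h1 h2
      rw [getElem_qdv]
      simp only [List.length_cons] at h2 ⊢
      rcases i with _ | _ | i
      · rw [hpart0 _ (by omega)]; simp
      · rw [hpart0 _ (by omega)]; simp
      · have hwi : ∀ (h : i < w.length), w[i] = ((i : ℤ) + 1) - γ.part (m - 1 - i) := by simp [hw]
        simp only [List.getElem_cons_succ]
        rw [hpart _ (by omega), hwi]
        rw [show w.length + 1 + 1 - 1 - (i + 1 + 1) + 1 = m - 1 - i by omega]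
        push_cast; ring

theorem part_zero_ofQDV_append {v : List ℤ} {a : ℤ} (hv : IsQDV (v ++ [a])) :
    ((ofQDV (v ++ [a])).part 0 : ℤ) = v.length - a := by
  have h := (qdv_ofQDV _ hv).2
  have h1 : v.length < (qdv (v ++ [a]).length (ofQDV (v ++ [a]))).length := by simp
  have e := getElem_qdv _ _ _ h1
  simp only [h] at e
  simp at e
  linarith

theorem nextDown1_iff {γ δ : IntPartition} : NextDown1 γ δ ↔
    ∃ w, SlowlyIncreasing (0 :: (w ++ [0])) ∧ γ = ofQDV (0 :: (w ++ [0])) ∧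
      δ = ofQDV (0 :: 1 :: w) := by
  constructor
  · rintro ⟨h0, hl, rfl⟩
    obtain ⟨w, h1, h2, h3⟩ := exists_nextDown1_rep h0 hl
    exact ⟨w, h1, h2, h3⟩
  · rintro ⟨w, h1, h2, rfl⟩
    have hQ : IsQDV ((0 :: w) ++ [0]) := isQDV_cons.2 ⟨rfl, h1⟩
    have hp := part_zero_ofQDV_append hQ
    have hlt := (qdv_ofQDV _ hQ).1
    rw [List.cons_append, ← h2] at hp hlt
    simp only [List.length_cons, List.length_append, List.length_nil] at hp hlt
    have hp' : γ.part 0 = w.length + 1 := by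
      have : (γ.part 0 : ℤ) = ((w.length + 1 : ℕ) : ℤ) := by rw [hp]; push_cast; ring
      exact_mod_cast this
    have h0 : 0 < γ.length := by
      by_contra h
      have := (part_eq_zero_iff γ 0).2 (by omega)
      omega
    have hl : γ.length ≤ γ.part 0 := by omega
    obtain ⟨w', h1', h2', h3'⟩ := exists_nextDown1_rep h0 hl
    refine ⟨h0, hl, ?_⟩
    have hQ' : IsQDV ((0 :: w') ++ [0]) := isQDV_cons.2 ⟨rfl, h1'⟩
    have := eq_of_ofQDV_eq_of_getLast? (a := 0) hQ hQ' (by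
      rw [List.cons_append, List.cons_append, ← h2, ← h2']) List.getLast?_concat List.getLast?_concat
    have e : w = w' := by simpa using this
    rw [h3', e]

/-! ### Slowly increasing lists -/

theorem slow_append {l m : List ℤ} : SlowlyIncreasing (l ++ m) ↔
    SlowlyIncreasing l ∧ SlowlyIncreasing m ∧ ∀ x ∈ l.getLast?, ∀ y ∈ m.head?, y ≤ x + 1 :=
  List.isChain_append

theorem slow_cons {a : ℤ} {m : List ℤ} : SlowlyIncreasing (a :: m) ↔
    (∀ y ∈ m.head?, y ≤ a + 1) ∧ SlowlyIncreasing m :=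
  List.isChain_cons

theorem slow_replicate (n : ℕ) (a : ℤ) : SlowlyIncreasing (List.replicate n a) := by
  refine List.isChain_iff_getElem.2 fun i hi => ?_
  simp

/-- One criterion for all the source and target words of ND₂. The hypothesis `h3` covers an empty
middle block, where `l` meets `r` directly. -/
theorem slow_wrap {l A r : List ℤ} {p q : ℤ} (hl : SlowlyIncreasing l) (hA : SlowlyIncreasing A)
    (hr : SlowlyIncreasing r) (hp : l.getLast? = some p) (hq : ∀ x ∈ r.head?, x ≤ q)
    (h1 : ∀ x ∈ A.head?, x ≤ p + 1) (h2 : ∀ x ∈ A.getLast?, q ≤ x + 1) (h3 : q ≤ p + 1) :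
    SlowlyIncreasing (l ++ A ++ r) := by
  rw [slow_append, slow_append]
  refine ⟨⟨hl, hA, ?_⟩, hr, ?_⟩
  · intro x hx y hy
    rw [hp] at hx
    cases hx
    exact h1 y hy
  · intro x hx y hy
    have hy' := hq y hy
    rw [List.getLast?_append] at hx
    cases hA' : A.getLast? with
    | none =>
      rw [hA', hp] at hx
      cases hx
      linarith
    | some b =>
      rw [hA'] at hx
      cases hx
      have := h2 x (by rw [hA']; rfl)
      linarith

/-! ### Runs -/

/-- The letter b ≠ a stops the run, so its length is exactly h. Such comparisons recover the
parameters h and k from the words. -/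
theorem run_le {h m : ℕ} {a b : ℤ} {X Y : List ℤ}
    (e : List.replicate h a ++ b :: X = List.replicate m a ++ Y) (hb : b ≠ a) : m ≤ h := by
  induction h generalizing m with
  | zero =>
    cases m with
    | zero => exact le_rfl
    | succ m =>
      simp [List.replicate_succ] at e
      exact absurd e.1 hb
  | succ h ih =>
    cases m with
    | zero => omega
    | succ m =>
      have := @ih m (by simpa [List.replicate_succ] using e)
      omega

theorem run_le_right {h m : ℕ} {a b : ℤ} {X Y : List ℤ}
    (e : X ++ b :: List.replicate h a = Y ++ List.replicate m a) (hb : b ≠ a) : m ≤ h := by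
  have := congrArg List.reverse e
  simp only [List.reverse_append, List.reverse_cons, List.reverse_replicate, List.append_assoc,
    List.singleton_append] at this
  exact run_le this hb

/-! ### The map `NU₂` on vectors -/

/-- Source of the first rule of `ND₂`. -/
def srcA (h : ℕ) (A : List ℤ) : List ℤ := List.replicate h 0 ++ [1] ++ A ++ List.replicate h 1
/-- Target of the first rule of `ND₂`. -/
def tgtA (h : ℕ) (A : List ℤ) : List ℤ :=
  [0, 1] ++ List.replicate h 2 ++ A ++ List.replicate (h - 1) (-1)
/-- Source of the second rule of `ND₂`. -/
def srcB (k : ℕ) (B : List ℤ) : List ℤ := List.replicate (k + 1) 0 ++ B ++ [0] ++ List.replicate k 1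
/-- Target of the second rule of `ND₂`. -/
def tgtB (k : ℕ) (B : List ℤ) : List ℤ :=
  [0, 1] ++ List.replicate k 2 ++ B ++ List.replicate k (-1)

/-- The side conditions of the first rule of `ND₂`. -/
structure CondA (h : ℕ) (A : List ℤ) : Prop where
  two_le : 2 ≤ h
  slow : SlowlyIncreasing A
  le_two : ∀ x ∈ A, x ≤ 2
  last : ∀ x ∈ A.getLast?, 0 ≤ x

/-- The side conditions of the second rule of `ND₂`. -/
structure CondB (k : ℕ) (B : List ℤ) : Prop where
  one_le : 1 ≤ k
  slow : SlowlyIncreasing B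
  le_two : ∀ x ∈ B, x ≤ 2
  head : ∀ x ∈ B.head?, x ≤ 1
  last : ∀ x ∈ B.getLast?, -1 ≤ x

theorem nextUp2_iff {δ γ : IntPartition} : NextUp2 δ γ ↔
    (∃ h A, CondA h A ∧ δ = ofQDV (tgtA h A) ∧ γ = ofQDV (srcA h A)) ∨
    (∃ k B, CondB k B ∧ δ = ofQDV (tgtB k B) ∧ γ = ofQDV (srcB k B)) := by
  constructor
  · rintro (⟨h, A, h1, h2, h3, h4, h5, h6⟩ | ⟨k, B, h1, h2, h3, h4, h5, h6, h7⟩)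
    · exact .inl ⟨h, A, ⟨h1, h2, h3, h4⟩, h5, h6⟩
    · exact .inr ⟨k, B, ⟨h1, h2, h3, h4, h5⟩, h6, h7⟩
  · rintro (⟨h, A, ⟨h1, h2, h3, h4⟩, h5, h6⟩ | ⟨k, B, ⟨h1, h2, h3, h4, h5⟩, h6, h7⟩)
    · exact .inl ⟨h, A, h1, h2, h3, h4, h5, h6⟩
    · exact .inr ⟨k, B, h1, h2, h3, h4, h5, h6, h7⟩

theorem head?_mem_le {A : List ℤ} {c : ℤ} (h : ∀ x ∈ A, x ≤ c) : ∀ x ∈ A.head?, x ≤ c :=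
  fun x hx => h x (List.mem_of_head? hx)

theorem slow_zero_one_two (h : ℕ) : SlowlyIncreasing ([0, 1] ++ List.replicate h 2) := by
  rw [slow_append]
  refine ⟨by simp [SlowlyIncreasing], slow_replicate _ _, ?_⟩
  simp [List.head?_replicate]

theorem getLast?_zero_one_two {h : ℕ} (hh : h ≠ 0) :
    ([0, 1] ++ List.replicate h (2 : ℤ)).getLast? = some 2 := by
  rw [List.getLast?_append, List.getLast?_replicate, if_neg hh]; rfl

theorem head?_replicate_le (n : ℕ) (a : ℤ) : ∀ x ∈ (List.replicate n a).head?, x ≤ a := by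
  intro x hx
  exact (List.eq_of_mem_replicate (List.mem_of_head? hx)).le

theorem slow_tgt {h m : ℕ} {A : List ℤ} (hh : h ≠ 0) (hs : SlowlyIncreasing A)
    (h2 : ∀ x ∈ A, x ≤ 2) (hl : ∀ x ∈ A.getLast?, -2 ≤ x) :
    SlowlyIncreasing ([0, 1] ++ List.replicate h 2 ++ A ++ List.replicate m (-1)) := by
  refine slow_wrap (p := 2) (q := -1) (slow_zero_one_two h) hs (slow_replicate _ _)
    (getLast?_zero_one_two hh) (head?_replicate_le _ _) ?_ ?_ (by norm_num)
  · intro x hx; linarith [head?_mem_le h2 x hx]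
  · intro x hx; linarith [hl x hx]

theorem isQDV_of_slow {v : List ℤ} (h0 : v.head? = some 0) (hs : SlowlyIncreasing v) : IsQDV v :=
  ⟨h0, hs⟩

theorem CondA.isQDV_tgt {h : ℕ} {A : List ℤ} (c : CondA h A) : IsQDV (tgtA h A) :=
  isQDV_of_slow (by simp [tgtA]) (slow_tgt (by have := c.two_le; omega) c.slow c.le_two
    fun x hx => by linarith [c.last x hx])

theorem CondB.isQDV_tgt {h : ℕ} {A : List ℤ} (c : CondB h A) : IsQDV (tgtB h A) :=
  isQDV_of_slow (by simp [tgtB]) (slow_tgt (by have := c.one_le; omega) c.slow c.le_two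
    fun x hx => by linarith [c.last x hx])

theorem CondA.isQDV_src {h : ℕ} {A : List ℤ} (c : CondA h A) : IsQDV (srcA h A) := by
  have hh := c.two_le
  refine isQDV_of_slow ?_ (slow_wrap (p := 1) (q := 1) ?_ c.slow (slow_replicate _ _) (by simp)
    (head?_replicate_le _ _) ?_ ?_ (by norm_num))
  · obtain ⟨h, rfl⟩ : ∃ m, h = m + 1 := ⟨h - 1, by omega⟩
    simp [srcA, List.replicate_succ]
  · rw [slow_append]
    refine ⟨slow_replicate _ _, by simp [SlowlyIncreasing], ?_⟩
    rw [List.getLast?_replicate]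
    split_ifs <;> simp
  · intro x hx; linarith [head?_mem_le c.le_two x hx]
  · intro x hx; linarith [c.last x hx]

theorem CondB.isQDV_src {k : ℕ} {B : List ℤ} (c : CondB k B) : IsQDV (srcB k B) := by
  refine isQDV_of_slow (by simp [srcB, List.replicate_succ]) ?_
  rw [srcB, List.append_assoc]
  refine slow_wrap (p := 0) (q := 0) (slow_replicate _ _) c.slow ?_ ?_ (by simp) ?_ ?_ (by norm_num)
  · rw [slow_append]
    refine ⟨by simp [SlowlyIncreasing], slow_replicate _ _, ?_⟩
    intro x hx y hy
    have := head?_replicate_le _ _ y hy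
    simp at hx
    omega
  · rw [List.getLast?_replicate, if_neg (by omega)]
  · intro x hx; linarith [c.head x hx]
  · intro x hx; linarith [c.last x hx]

theorem CondA.src_eq {h : ℕ} {A : List ℤ} (c : CondA h A) :
    ∃ x, srcA h A = 0 :: 0 :: (x ++ [1]) := by
  have hh := c.two_le
  obtain ⟨h, rfl⟩ : ∃ m, h = m + 2 := ⟨h - 2, by omega⟩
  refine ⟨List.replicate h 0 ++ [1] ++ A ++ List.replicate (h + 1) 1, ?_⟩
  rw [srcA, show List.replicate (h + 2) (1 : ℤ) = List.replicate (h + 1) 1 ++ [1] from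
    List.replicate_succ']
  simp [List.replicate_succ]

theorem CondB.src_eq {k : ℕ} {B : List ℤ} (c : CondB k B) :
    ∃ x, srcB k B = 0 :: 0 :: (x ++ [1]) := by
  have hh := c.one_le
  obtain ⟨k, rfl⟩ : ∃ m, k = m + 1 := ⟨k - 1, by omega⟩
  refine ⟨List.replicate k 0 ++ B ++ [0] ++ List.replicate k 1, ?_⟩
  rw [srcB, show List.replicate (k + 1) (1 : ℤ) = List.replicate k 1 ++ [1] from
    List.replicate_succ']
  simp [List.replicate_succ]

theorem CondA.tgt_getLast? {h : ℕ} {A : List ℤ} (c : CondA h A) :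
    (tgtA h A).getLast? = some (-1) := by
  have := c.two_le
  rw [tgtA, List.getLast?_append, List.getLast?_replicate, if_neg (by omega)]; rfl

theorem CondB.tgt_getLast? {h : ℕ} {A : List ℤ} (c : CondB h A) :
    (tgtB h A).getLast? = some (-1) := by
  have := c.one_le
  rw [tgtB, List.getLast?_append, List.getLast?_replicate, if_neg (by omega)]; rfl

theorem srcA_inj {h h' : ℕ} {A A' : List ℤ} (e : srcA h A = srcA h' A') : h = h' ∧ A = A' := by
  simp only [srcA, List.append_assoc, List.singleton_append] at e
  have : h = h' := le_antisymm (run_le e.symm one_ne_zero) (run_le e one_ne_zero)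
  subst this
  simpa using e

theorem srcB_inj {k k' : ℕ} {B B' : List ℤ} (e : srcB k B = srcB k' B') : k = k' ∧ B = B' := by
  simp only [srcB, List.append_assoc, List.singleton_append] at e
  have : k = k' := by
    simp only [← List.append_assoc] at e
    have h1 := @run_le_right k k' 1 0 _ (List.replicate (k' + 1) 0 ++ B' ++ [0])
      (by rw [e]; simp) (by norm_num)
    have h2 := @run_le_right k' k 1 0 _ (List.replicate (k + 1) 0 ++ B ++ [0])
      (by rw [← e]; simp) (by norm_num)
    omega
  subst this
  simpa using e

/-- In a source of the first rule the leading zeros number exactly h and the trailing ones at least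
h. In one of the second rule the trailing ones number exactly k and the leading zeros at least k +
1. -/
theorem srcA_ne_srcB {h k : ℕ} {A B : List ℤ} : srcA h A ≠ srcB k B := by
  intro e
  have h1 : k + 1 ≤ h := by
    simp only [srcA, srcB, List.append_assoc, List.singleton_append] at e
    exact run_le e one_ne_zero
  have h2 : h ≤ k := by
    rw [srcA, srcB, List.append_assoc _ [0]] at e
    exact run_le_right e.symm zero_ne_one
  omega

theorem exists_concat_ne {c : ℤ} {h : ℕ} {A : List ℤ} (hh : h ≠ 0) (hc : c < 2)
    (hA : ∀ x ∈ A.getLast?, c < x) :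
    ∃ X b, [0, 1] ++ List.replicate h 2 ++ A = X ++ [b] ∧ b ≠ c := by
  rcases List.eq_nil_or_concat A with rfl | ⟨A, b, rfl⟩
  · obtain ⟨h, rfl⟩ := Nat.exists_eq_succ_of_ne_zero hh
    exact ⟨[0, 1] ++ List.replicate h 2, 2, by simp [List.replicate_succ'], hc.ne'⟩
  · refine ⟨[0, 1] ++ List.replicate h 2 ++ A, b, by simp, ?_⟩
    have := hA b (by simp)
    exact this.ne'

theorem tgtA_run_le {h m : ℕ} {A Y : List ℤ} (c : CondA h A)
    (e : tgtA h A = Y ++ List.replicate m (-1)) : m ≤ h - 1 := by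
  have hh := c.two_le
  obtain ⟨X, b, hX, hb⟩ := exists_concat_ne (c := -1) (h := h) (A := A) (by omega) (by norm_num)
    (fun x hx => by linarith [c.last x hx])
  rw [tgtA, hX, List.append_assoc] at e
  exact run_le_right e hb

theorem tgtB_run_le {k m : ℕ} {B Y : List ℤ} (c : CondB k B)
    (e : tgtB k B = [0, 1] ++ (List.replicate m 2 ++ Y)) : m ≤ k := by
  have hh := c.one_le
  obtain ⟨k, rfl⟩ : ∃ m, k = m + 1 := ⟨k - 1, by omega⟩
  obtain ⟨b, X, hX, hb⟩ : ∃ b X, B ++ List.replicate (k + 1) (-1) = b :: X ∧ b ≠ 2 := by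
    cases hB : B with
    | nil => exact ⟨-1, List.replicate k (-1), by simp [List.replicate_succ], by norm_num⟩
    | cons b B' =>
      have := c.head b (by simp [hB])
      exact ⟨b, _, rfl, by omega⟩
  rw [tgtB, List.append_assoc, hX, List.append_assoc, List.append_cancel_left_eq] at e
  exact run_le e hb

theorem tgtA_inj {h h' : ℕ} {A A' : List ℤ} (c : CondA h A) (c' : CondA h' A')
    (e : tgtA h A = tgtA h' A') : h = h' ∧ A = A' := by
  have := c.two_le
  have := c'.two_le
  have h1 := tgtA_run_le c e
  have h2 := tgtA_run_le c' e.symm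
  obtain rfl : h = h' := by omega
  simpa [tgtA] using e

theorem tgtB_inj {h h' : ℕ} {A A' : List ℤ} (c : CondB h A) (c' : CondB h' A')
    (e : tgtB h A = tgtB h' A') : h = h' ∧ A = A' := by
  have h1 := tgtB_run_le c (e.trans (by rw [tgtB, List.append_assoc, List.append_assoc]))
  have h2 := tgtB_run_le c' (e.symm.trans (by rw [tgtB, List.append_assoc, List.append_assoc]))
  obtain rfl : h = h' := by omega
  simpa [tgtB] using e

/-- After 0 1, the run of 2s is longer than the final run of -1s in a target of the first rule, and
not longer in one of the second. -/
theorem tgtA_ne_tgtB {h k : ℕ} {A B : List ℤ} (c : CondA h A) (c' : CondB k B) :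
    tgtA h A ≠ tgtB k B := by
  intro e
  have := c.two_le
  have h1 := tgtA_run_le c e
  have h2 := tgtB_run_le c' (e.symm.trans (by rw [tgtA, List.append_assoc, List.append_assoc]))
  omega

/-! ### The map `ND` is a partial injection -/

/-- The word is the shortest of its class and ends above 0; raising increases the last entry
further, so no representative ends in 0. -/
theorem not_nextDown1_of_start {x : List ℤ} {a : ℤ} (ha : 0 < a)
    (hv : IsQDV (0 :: 0 :: (x ++ [a]))) (δ : IntPartition) :
    ¬ NextDown1 (ofQDV (0 :: 0 :: (x ++ [a]))) δ := by
  rw [nextDown1_iff]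
  rintro ⟨w, h1, h2, -⟩
  obtain ⟨k, hk⟩ := iterate_up_of_ofQDV_eq hv (isQDV_cons.2 ⟨rfl, h1⟩) h2
  have l1 : (0 :: 0 :: (x ++ [a])).getLast? = some a := by
    rw [← List.cons_append, ← List.cons_append]; exact List.getLast?_concat
  have l2 : (0 :: (w ++ [0])).getLast? = some (0 : ℤ) := by
    rw [← List.cons_append]; exact List.getLast?_concat
  rcases hk with hk | hk
  · have := getLast?_iterate_up l1 k
    rw [← hk, l2] at this
    simp at this
    omega
  · cases k with
    | zero =>
      have e : (0 :: 0 :: (x ++ [a])) = 0 :: (w ++ [0]) := hk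
      rw [e, l2] at l1
      simp at l1
      omega
    | succ k =>
      obtain ⟨y, hy⟩ := iterate_up_succ_eq _ (isQDV_cons.2 ⟨rfl, h1⟩) k
      rw [hy] at hk
      simp at hk

theorem not_nextDown1_of_nextUp2 {γ δ δ' : IntPartition} (h : NextUp2 δ γ) :
    ¬ NextDown1 γ δ' := by
  rcases nextUp2_iff.1 h with ⟨h, A, c, -, rfl⟩ | ⟨k, B, c, -, rfl⟩
  · obtain ⟨x, hx⟩ := c.src_eq
    have hv := c.isQDV_src
    rw [hx] at hv ⊢
    exact not_nextDown1_of_start one_pos hv δ'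
  · obtain ⟨x, hx⟩ := c.src_eq
    have hv := c.isQDV_src
    rw [hx] at hv ⊢
    exact not_nextDown1_of_start one_pos hv δ'

theorem eq_of_ofQDV_eq_of_exists_start {v w : List ℤ} (hv : IsQDV v) (hw : IsQDV w)
    (hv' : ∃ x, v = 0 :: 0 :: (x ++ [1])) (hw' : ∃ x, w = 0 :: 0 :: (x ++ [1]))
    (h : ofQDV v = ofQDV w) : v = w := by
  obtain ⟨x, rfl⟩ := hv'
  obtain ⟨y, rfl⟩ := hw'
  rw [eq_of_ofQDV_eq_of_start hv hw h]

theorem nextUp2_right_unique {γ δ δ' : IntPartition} (h : NextUp2 δ γ) (h' : NextUp2 δ' γ) :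
    δ = δ' := by
  rcases nextUp2_iff.1 h with ⟨h, A, c, rfl, rfl⟩ | ⟨k, B, c, rfl, rfl⟩ <;>
  rcases nextUp2_iff.1 h' with ⟨h', A', c', rfl, e⟩ | ⟨k', B', c', rfl, e⟩ <;>
  have e' := eq_of_ofQDV_eq_of_exists_start c.isQDV_src c'.isQDV_src c.src_eq c'.src_eq e
  · obtain ⟨rfl, rfl⟩ := srcA_inj e'; rfl
  · exact absurd e' srcA_ne_srcB
  · exact absurd e'.symm srcA_ne_srcB
  · obtain ⟨rfl, rfl⟩ := srcB_inj e'; rfl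

theorem nextUp2_left_unique {γ γ' δ : IntPartition} (h : NextUp2 δ γ) (h' : NextUp2 δ γ') :
    γ = γ' := by
  rcases nextUp2_iff.1 h with ⟨h, A, c, rfl, rfl⟩ | ⟨k, B, c, rfl, rfl⟩ <;>
  rcases nextUp2_iff.1 h' with ⟨h', A', c', e, rfl⟩ | ⟨k', B', c', e, rfl⟩ <;>
  have e' := eq_of_ofQDV_eq_of_getLast? c.isQDV_tgt c'.isQDV_tgt e c.tgt_getLast? c'.tgt_getLast?
  · obtain ⟨rfl, rfl⟩ := tgtA_inj c c' e'; rfl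
  · exact absurd e' (tgtA_ne_tgtB c c')
  · exact absurd e'.symm (tgtA_ne_tgtB c' c)
  · obtain ⟨rfl, rfl⟩ := tgtB_inj c c' e'; rfl

theorem nextDown_right_unique {γ δ δ' : IntPartition} (h : NextDown γ δ) (h' : NextDown γ δ') :
    δ = δ' := by
  rcases h with h | h <;> rcases h' with h' | h'
  · rw [h.2.2, h'.2.2]
  · exact absurd h (not_nextDown1_of_nextUp2 h')
  · exact absurd h' (not_nextDown1_of_nextUp2 h)
  · exact nextUp2_right_unique h h'

theorem slow_dropLast {a b : ℤ} {w : List ℤ} (h : SlowlyIncreasing (a :: (w ++ [b]))) :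
    SlowlyIncreasing (a :: w) := by
  rw [← List.cons_append] at h
  exact (slow_append.1 h).1

/-- A vector starting with `0, 1, 2` and ending with `-1` is not of the form `0 1 w` with
`w` as in the description of `ND₁`, up to equivalence. -/
theorem not_nextDown1_tgt {v x : List ℤ} {γ : IntPartition} (hv : IsQDV v)
    (hx : v = 0 :: 1 :: 2 :: x) (hl : v.getLast? = some (-1)) : ¬ NextDown1 γ (ofQDV v) := by
  rw [nextDown1_iff]
  rintro ⟨w, h1, -, h2⟩
  have hw : IsQDV (0 :: 1 :: w) := isQDV_cons.2 ⟨rfl, slow_cons_one h1⟩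
  obtain ⟨k, hk⟩ := iterate_up_of_ofQDV_eq hv hw h2
  -- In the source 0 w 0 the block w sits between zeros, which bounds both its ends. The first bound
  -- separates 0 1 w from words starting with 0 1 2; the second leaves no room for raising, because
  -- v ends in -1.
  have hhead : ∀ y ∈ w.head?, y ≤ 1 := by
    intro y hy
    have := (slow_cons.1 h1).1 y (by rw [List.head?_append, hy]; rfl)
    linarith
  have hlast : ∀ y ∈ w.getLast?, -1 ≤ y := by
    intro y hy
    rw [← List.cons_append] at h1
    have := (slow_append.1 h1).2.2 y (by rw [List.getLast?_cons, hy]; rfl) 0 rfl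
    linarith
  have hup : ∀ u : List ℤ, (∃ y, u = 0 :: 1 :: y) → ∃ y, up u = 0 :: 1 :: 2 :: y := by
    rintro _ ⟨y, rfl⟩
    exact ⟨y.map (· + 1), by simp [up]⟩
  have no : ∀ u : List ℤ, (∃ y, u = 0 :: 1 :: y) → up u ≠ 0 :: 1 :: w := by
    intro u hu e
    obtain ⟨y, hy⟩ := hup u hu
    rw [hy] at e
    have : w = 2 :: y := by simpa using e.symm
    have := hhead 2 (by rw [this]; rfl)
    norm_num at this
  rcases hk with hk | hk
  · cases k with
    | zero =>
      have e : 0 :: 1 :: w = v := hk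
      have : w = 2 :: x := by simpa using e.trans hx
      have := hhead 2 (by rw [this]; rfl)
      norm_num at this
    | succ k =>
      rw [Function.iterate_succ_apply'] at hk
      refine no _ ?_ hk.symm
      cases k with
      | zero => exact ⟨2 :: x, hx⟩
      | succ k => exact iterate_up_succ_eq _ hv k
  · obtain ⟨a, ha⟩ : ∃ a, (0 :: 1 :: w).getLast? = some a :=
      Option.isSome_iff_exists.1 (by simp)
    have h3 := getLast?_iterate_up ha k
    rw [← hk, hl] at h3
    have h4 : -1 ≤ a := by
      rcases List.eq_nil_or_concat w with rfl | ⟨w, b, rfl⟩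
      · simp at ha; omega
      · have := hlast b (by simp)
        have e : (0 :: 1 :: (w ++ [b])).getLast? = some b := by
          rw [← List.cons_append, ← List.cons_append]; exact List.getLast?_concat
        rw [List.concat_eq_append, e] at ha
        cases ha
        exact this
    have h5 : k = 0 := by
      simp at h3; omega
    subst h5
    have : w = 2 :: x := by
      have e : v = 0 :: 1 :: w := hk
      simpa using e.symm.trans hx
    have := hhead 2 (by rw [this]; rfl)
    norm_num at this

theorem CondA.tgt_eq {h : ℕ} {A : List ℤ} (c : CondA h A) : ∃ x, tgtA h A = 0 :: 1 :: 2 :: x := by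
  have := c.two_le
  obtain ⟨h, rfl⟩ : ∃ m, h = m + 1 := ⟨h - 1, by omega⟩
  simp only [tgtA, List.replicate_succ, List.cons_append, List.nil_append]
  exact ⟨_, rfl⟩

theorem CondB.tgt_eq {h : ℕ} {A : List ℤ} (c : CondB h A) : ∃ x, tgtB h A = 0 :: 1 :: 2 :: x := by
  have := c.one_le
  obtain ⟨h, rfl⟩ : ∃ m, h = m + 1 := ⟨h - 1, by omega⟩
  simp only [tgtB, List.replicate_succ, List.cons_append, List.nil_append]
  exact ⟨_, rfl⟩

theorem not_nextDown1_of_nextUp2' {γ γ' δ : IntPartition} (h : NextUp2 δ γ) :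
    ¬ NextDown1 γ' δ := by
  rcases nextUp2_iff.1 h with ⟨h, A, c, rfl, -⟩ | ⟨k, B, c, rfl, -⟩
  · obtain ⟨x, hx⟩ := c.tgt_eq
    exact not_nextDown1_tgt c.isQDV_tgt hx c.tgt_getLast?
  · obtain ⟨x, hx⟩ := c.tgt_eq
    exact not_nextDown1_tgt c.isQDV_tgt hx c.tgt_getLast?

/-- Raising 0 1 w gives a word starting with 0 1 2, whereas the block after 0 1 in an image of ND₁
starts with at most 1. -/
theorem nextDown1_left_unique {γ γ' δ : IntPartition} (h : NextDown1 γ δ) (h' : NextDown1 γ' δ) :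
    γ = γ' := by
  obtain ⟨w, h1, rfl, rfl⟩ := nextDown1_iff.1 h
  obtain ⟨w', h1', rfl, e⟩ := nextDown1_iff.1 h'
  have hw : IsQDV (0 :: 1 :: w) := isQDV_cons.2 ⟨rfl, slow_cons_one h1⟩
  have hw' : IsQDV (0 :: 1 :: w') := isQDV_cons.2 ⟨rfl, slow_cons_one h1'⟩
  have no : ∀ (k : ℕ) (w w' : List ℤ), IsQDV (0 :: 1 :: w) → SlowlyIncreasing (0 :: (w' ++ [0])) →
      0 :: 1 :: w' = up^[k] (0 :: 1 :: w) → w = w' := by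
    intro k w w' hw h1' hk
    cases k with
    | zero => simpa using hk.symm
    | succ k =>
      exfalso
      rw [Function.iterate_succ_apply'] at hk
      obtain ⟨y, hy⟩ : ∃ y, up^[k] (0 :: 1 :: w) = 0 :: 1 :: y := by
        cases k with
        | zero => exact ⟨w, rfl⟩
        | succ k => exact iterate_up_succ_eq _ hw k
      rw [hy] at hk
      have e : w' = 2 :: y.map (· + 1) := by simpa [up] using hk
      have := (slow_cons.1 h1').1 2 (by rw [e]; rfl)
      norm_num at this
  obtain ⟨k, hk⟩ := iterate_up_of_ofQDV_eq hw hw' e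
  have : w = w' := by
    rcases hk with hk | hk
    · exact no k w w' hw h1' hk
    · exact (no k w' w hw' h1 hk).symm
  rw [this]

theorem nextDown_left_unique {γ γ' δ : IntPartition} (h : NextDown γ δ) (h' : NextDown γ' δ) :
    γ = γ' := by
  rcases h with h | h <;> rcases h' with h' | h'
  · exact nextDown1_left_unique h h'
  · exact absurd h (not_nextDown1_of_nextUp2' h')
  · exact absurd h' (not_nextDown1_of_nextUp2' h)
  · exact nextUp2_left_unique h h'

/-! ### Minimum triangle height -/

/-- A shorter nonnegative representative, once raised, would have only positive entries after the
first. -/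
theorem minTri_ofQDV {x : List ℤ} (hv : IsQDV (0 :: x)) (hnn : ∀ a ∈ x, 0 ≤ a) (h0 : 0 ∈ x) :
    minTri (ofQDV (0 :: x)) = x.length + 1 := by
  obtain ⟨h1, h2⟩ := qdv_ofQDV _ hv
  set γ := ofQDV (0 :: x)
  have hmem : x.length + 1 ∈ {n : ℕ | γ.length < n ∧ ∀ y ∈ qdv n γ, 0 ≤ y} := by
    refine ⟨by simpa using h1, ?_⟩
    rw [← List.length_cons, h2]
    simpa using hnn
  refine le_antisymm (Nat.sInf_le hmem) ?_
  refine le_csInf ⟨_, hmem⟩ ?_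
  rintro m ⟨hm, hm'⟩
  by_contra hlt
  have hpos : ∀ d, ∀ y ∈ qdv (m + d) γ, 0 ≤ y := by
    intro d
    induction d with
    | zero => exact hm'
    | succ d ih =>
      intro y hy
      rw [← add_assoc, qdv_succ (by omega)] at hy
      rcases List.mem_cons.1 hy with rfl | hy
      · exact le_rfl
      · obtain ⟨z, hz, rfl⟩ := List.mem_map.1 hy
        linarith [ih z hz]
  obtain ⟨d, hd⟩ : ∃ d, (0 :: x).length = m + d + 1 := ⟨x.length - m, by simp; omega⟩
  rw [hd, qdv_succ (by omega)] at h2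
  have : x = (qdv (m + d) γ).map (· + 1) := by simpa using h2.symm
  rw [this] at h0
  obtain ⟨z, hz, hz'⟩ := List.mem_map.1 h0
  linarith [hpos d z hz]

/-! ### The deficit statistic -/

/-- `1` if the entries `a`, `b` (in this order) do not contribute to the diagonal inversions, except
through the value `b`. -/
def nonInv (a b : ℤ) : ℤ := if a < b ∨ b + 2 ≤ a then 1 else 0

/-- The number of pairs with first entry in `l`, second entry in `m`, counted by `nonInv`. -/
def cross (l m : List ℤ) : ℤ := (l.map fun a => (m.map (nonInv a)).sum).sum

/-- For a quasi-Dyck vector with nonnegative entries this is the deficit of its partition. -/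
def defc : List ℤ → ℤ
  | [] => 0
  | a :: l => defc l + (l.map (nonInv a)).sum - a

theorem nonInv_nonneg (a b : ℤ) : 0 ≤ nonInv a b := by unfold nonInv; split_ifs <;> norm_num

@[simp] theorem cross_nil_left (m : List ℤ) : cross [] m = 0 := rfl

@[simp] theorem cross_nil_right (l : List ℤ) : cross l [] = 0 := by simp [cross]

theorem cross_append_left (l l' m : List ℤ) : cross (l ++ l') m = cross l m + cross l' m := by
  simp [cross]

theorem cross_append_right (l m m' : List ℤ) : cross l (m ++ m') = cross l m + cross l m' := by
  simp [cross, List.sum_map_add]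

theorem cross_cons_left (a : ℤ) (l m : List ℤ) :
    cross (a :: l) m = (m.map (nonInv a)).sum + cross l m := by
  simp [cross]

theorem cross_cons_right (b : ℤ) (l m : List ℤ) :
    cross l (b :: m) = (l.map (nonInv · b)).sum + cross l m := by
  simp [cross, List.sum_map_add]

theorem cross_replicate_right (l : List ℤ) (n : ℕ) (b : ℤ) :
    cross l (List.replicate n b) = n * (l.map (nonInv · b)).sum := by
  simp [cross, List.sum_map_mul_left]

theorem cross_replicate_left (m : List ℤ) (n : ℕ) (a : ℤ) :
    cross (List.replicate n a) m = n * (m.map (nonInv a)).sum := by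
  simp [cross]

theorem cross_nonneg (l m : List ℤ) : 0 ≤ cross l m := by
  refine List.sum_nonneg fun x hx => ?_
  obtain ⟨a, -, rfl⟩ := List.mem_map.1 hx
  refine List.sum_nonneg fun x hx => ?_
  obtain ⟨b, -, rfl⟩ := List.mem_map.1 hx
  exact nonInv_nonneg a b

theorem defc_append (l m : List ℤ) : defc (l ++ m) = defc l + defc m + cross l m := by
  induction l with
  | nil => simp [defc]
  | cons a l ih => simp [defc, ih, cross_cons_left]; ring

@[simp] theorem defc_nil : defc [] = 0 := rfl

theorem defc_cons (a : ℤ) (l : List ℤ) :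
    defc (a :: l) = defc l + (l.map (nonInv a)).sum - a := rfl

theorem nonInv_self (a : ℤ) : nonInv a a = 0 := by simp [nonInv]

theorem defc_replicate (n : ℕ) (a : ℤ) : defc (List.replicate n a) = -(n * a) := by
  induction n with
  | zero => simp
  | succ n ih =>
    rw [List.replicate_succ, defc_cons, ih]
    simp [nonInv_self]; ring

theorem nonInv_add (a b c : ℤ) : nonInv (a + c) (b + c) = nonInv a b := by
  unfold nonInv
  congr 1
  simp only [eq_iff_iff]
  constructor <;> rintro (h | h) <;> first | (left; linarith) | (right; linarith)

theorem defc_map_add (l : List ℤ) (c : ℤ) : defc (l.map (· + c)) = defc l - l.length * c := by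
  induction l with
  | nil => simp
  | cons a l ih =>
    simp only [List.map_cons, defc_cons, ih, List.map_map, Function.comp_def, nonInv_add,
      List.length_cons]
    push_cast; ring

/-- The deficit of the partition represented by a quasi-Dyck vector with entries `≥ -1`. -/
def defu (v : List ℤ) : ℤ := defc (up v)

theorem defu_eq (v : List ℤ) : defu v = defc v - v.length + (v.map (nonInv (-1))).sum := by
  unfold defu up
  rw [defc_cons, defc_map_add, List.map_map]
  have : (nonInv 0 ∘ fun x => x + 1) = nonInv (-1) := by
    funext x
    exact nonInv_add (-1) x 1
  rw [this]; ring

/-- An unknown block enters the deficit computations only through its own deficit and its four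
letter counts. The invariance statements thus become polynomial identities, and the bounds
polynomial inequalities. -/
theorem sum_map_eq_count (f : ℤ → ℤ) {A : List ℤ} (h : ∀ a ∈ A, -1 ≤ a ∧ a ≤ 2) :
    (A.map f).sum = A.count (-1) * f (-1) + A.count 0 * f 0 + A.count 1 * f 1 + A.count 2 * f 2 := by
  induction A with
  | nil => simp
  | cons a A ih =>
    have ha := h a (by simp)
    rw [List.map_cons, List.sum_cons, ih fun b hb => h b (by simp [hb])]
    obtain ⟨h1, h2⟩ := ha
    interval_cases a <;> simp <;> ring

theorem length_eq_count {A : List ℤ} (h : ∀ a ∈ A, -1 ≤ a ∧ a ≤ 2) :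
    (A.length : ℤ) = A.count (-1) + A.count 0 + A.count 1 + A.count 2 := by
  have := sum_map_eq_count (fun _ => 1) h
  simpa using this

/-- The new leading 0 gains one pair with each entry, which cancels the loss from raising that entry
by 1. -/
theorem defu_of_nonneg {v : List ℤ} (h : ∀ a ∈ v, 0 ≤ a) : defu v = defc v := by
  rw [defu_eq]
  have : v.map (nonInv (-1)) = v.map fun _ => 1 := by
    refine List.map_congr_left fun a ha => ?_
    have := h a ha
    simp [nonInv]; omega
  rw [this]; simp

theorem defc_up_of_nonneg {v : List ℤ} (h : ∀ a ∈ v, 0 ≤ a) : defc (up v) = defc v :=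
  defu_of_nonneg h

theorem defc_iterate_up_of_nonneg {v : List ℤ} (h : ∀ a ∈ v, 0 ≤ a) (k : ℕ) :
    defc (up^[k] v) = defc v ∧ ∀ a ∈ up^[k] v, 0 ≤ a := by
  induction k with
  | zero => exact ⟨rfl, h⟩
  | succ k ih =>
    rw [Function.iterate_succ_apply']
    refine ⟨(defc_up_of_nonneg ih.2).trans ih.1, ?_⟩
    intro a ha
    rcases List.mem_cons.1 ha with rfl | ha
    · exact le_rfl
    · obtain ⟨b, hb, rfl⟩ := List.mem_map.1 ha
      linarith [ih.2 b hb]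

theorem defc_eq_of_ofQDV_eq {v w : List ℤ} (hv : IsQDV v) (hw : IsQDV w)
    (h : ofQDV v = ofQDV w) (hv0 : ∀ a ∈ v, 0 ≤ a) (hw0 : ∀ a ∈ w, 0 ≤ a) : defc v = defc w := by
  obtain ⟨k, rfl | rfl⟩ := iterate_up_of_ofQDV_eq hv hw h
  · exact (defc_iterate_up_of_nonneg hv0 k).1.symm
  · exact (defc_iterate_up_of_nonneg hw0 k).1

/-- Entries between `-1` and `2`. -/
def Ranged (x : List ℤ) : Prop := ∀ a ∈ x, -1 ≤ a ∧ a ≤ 2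

theorem nonInv_table :
    nonInv (-1) (-1) = 0 ∧ nonInv (-1) 0 = 1 ∧ nonInv (-1) 1 = 1 ∧ nonInv (-1) 2 = 1 ∧
    nonInv 0 (-1) = 0 ∧ nonInv 0 0 = 0 ∧ nonInv 0 1 = 1 ∧ nonInv 0 2 = 1 ∧
    nonInv 1 (-1) = 1 ∧ nonInv 1 0 = 0 ∧ nonInv 1 1 = 0 ∧ nonInv 1 2 = 1 ∧
    nonInv 2 (-1) = 1 ∧ nonInv 2 0 = 1 ∧ nonInv 2 1 = 0 ∧ nonInv 2 2 = 0 := by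
  norm_num [nonInv]

/-- Only pairs with the moved letter and its own value change; the pairs inside w cancel. -/
theorem defu_rotate_zero {w : List ℤ} (hw : Ranged w) :
    defu (0 :: (w ++ [0])) = defu (0 :: 1 :: w) := by
  simp only [defu_eq, defc_cons, defc_append, cross_cons_right, cross_nil_right, defc_nil, List.map_append,
    List.map_cons, List.map_nil, List.sum_append, List.sum_cons, List.sum_nil,
    List.length_cons, List.length_append, List.length_nil]
  simp only [sum_map_eq_count _ hw, nonInv_table]
  push_cast; ring

theorem defu_rotate_neg {w : List ℤ} (hw : Ranged w) :
    defu (0 :: (w ++ [-1])) = defu (0 :: 0 :: w) := by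
  simp only [defu_eq, defc_cons, defc_append, cross_cons_right, cross_nil_right, defc_nil, List.map_append,
    List.map_cons, List.map_nil, List.sum_append, List.sum_cons, List.sum_nil,
    List.length_cons, List.length_append, List.length_nil]
  simp only [sum_map_eq_count _ hw, nonInv_table]
  push_cast; ring

theorem defu_rotate_one {w : List ℤ} (hw : Ranged w) :
    defu (0 :: 1 :: (w ++ [1])) = defu (0 :: 1 :: 2 :: w) := by
  simp only [defu_eq, defc_cons, defc_append, cross_cons_right, cross_nil_right, defc_nil, List.map_append,
    List.map_cons, List.map_nil, List.sum_append, List.sum_cons, List.sum_nil,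
    List.length_cons, List.length_append, List.length_nil]
  simp only [sum_map_eq_count _ hw, nonInv_table]
  push_cast; ring

theorem defu_srcA {h : ℕ} {A : List ℤ} (hA : Ranged A) (hh : 1 ≤ h) :
    defu (srcA h A) = defu (tgtA h A) := by
  obtain ⟨h, rfl⟩ : ∃ m, h = m + 1 := ⟨h - 1, by omega⟩
  simp only [srcA, tgtA, defu_eq, defc_cons, defc_append, cross_cons_right, cross_cons_left,
    cross_append_left, cross_replicate_right, cross_replicate_left,
    defc_replicate,
    cross_nil_left, cross_nil_right, defc_nil, List.map_append, List.map_replicate, List.sum_replicate, List.length_replicate,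
    List.map_cons, List.map_nil, List.sum_append, List.sum_cons, List.sum_nil,
    List.length_cons, List.length_append, List.length_nil, nsmul_eq_mul, Nat.add_sub_cancel]
  simp only [sum_map_eq_count _ hA, nonInv_table]
  push_cast
  rw [length_eq_count hA]; ring

theorem defu_srcB {k : ℕ} {B : List ℤ} (hB : Ranged B) :
    defu (srcB k B) = defu (tgtB k B) := by
  simp only [srcB, tgtB, defu_eq, defc_cons, defc_append, cross_cons_right, cross_cons_left,
    cross_append_left, cross_replicate_right, cross_replicate_left,
    defc_replicate,
    cross_nil_left, cross_nil_right, defc_nil, List.map_append, List.map_replicate, List.sum_replicate, List.length_replicate,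
    List.map_cons, List.map_nil, List.sum_append, List.sum_cons, List.sum_nil,
    List.length_cons, List.length_append, List.length_nil, nsmul_eq_mul]
  simp only [sum_map_eq_count _ hB, nonInv_table]
  push_cast
  rw [length_eq_count hB]; ring

/-! ### An invariant of the orbits of tail initiators -/

/-- Lists `x` with entries between `-1` and `2`, in which no `2` follows a `-1`, and which start with
`0` or contain `-1`. -/
structure Tame (x : List ℤ) : Prop where
  slow : SlowlyIncreasing (0 :: x)
  ranged : Ranged x
  pw : x.Pairwise fun a b => a = -1 → b ≤ 1
  start : -1 ∈ x ∨ x.head? = some 0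

theorem Tame.isQDV {x : List ℤ} (h : Tame x) : IsQDV (0 :: x) := isQDV_cons.2 ⟨rfl, h.slow⟩

theorem Tame.ne_nil {x : List ℤ} (h : Tame x) : x ≠ [] := by
  rintro rfl
  rcases h.start with h | h <;> simp at h

theorem Tame.last_le_one {x : List ℤ} {a : ℤ} (h : Tame (x ++ [a])) (hm : -1 ∈ x ++ [a]) :
    a ≤ 1 := by
  rcases List.mem_append.1 hm with hm | hm
  · exact (List.pairwise_append.1 h.pw).2.2 _ hm a (by simp) rfl
  · simp at hm; omega

theorem Ranged.sublist {x y : List ℤ} (h : Ranged y) (hs : x.Sublist y) : Ranged x :=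
  fun a ha => h a (hs.subset ha)

/-- The property of being represented by a tame list, with deficit `n`. -/
def Reach (n : ℤ) (γ : IntPartition) : Prop :=
  ∃ x, Tame x ∧ defu (0 :: x) = n ∧ γ = ofQDV (0 :: x)

theorem getLast?_cons_concat (a b : ℤ) (w : List ℤ) : (a :: (w ++ [b])).getLast? = some b := by
  rw [← List.cons_append]; exact List.getLast?_concat

theorem slow_cons_cons {a b : ℤ} {w : List ℤ} :
    SlowlyIncreasing (a :: b :: w) ↔ b ≤ a + 1 ∧ SlowlyIncreasing (b :: w) := by
  rw [slow_cons]; simp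

theorem slow_add_cons {a c : ℤ} {w : List ℤ} :
    SlowlyIncreasing ((a + c) :: w.map (· + c)) ↔ SlowlyIncreasing (a :: w) := by
  rw [← slow_map_add (v := a :: w) c, List.map_cons]

theorem Tame.reach_rotate_zero {w : List ℤ} (h : Tame (w ++ [0])) (hm : -1 ∈ w ++ [0]) :
    Reach (defu (0 :: (w ++ [0]))) (ofQDV (0 :: 1 :: w)) := by
  refine ⟨1 :: w, ⟨slow_cons_one h.slow, ?_, ?_, ?_⟩, ?_, rfl⟩
  · intro a ha
    rcases List.mem_cons.1 ha with rfl | ha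
    · norm_num
    · exact h.ranged a (by simp [ha])
  · exact List.pairwise_cons.2 ⟨fun _ _ h => by norm_num at h, (List.pairwise_append.1 h.pw).1⟩
  · left
    simpa using hm
  · exact (defu_rotate_zero (h.ranged.sublist (by simp))).symm

theorem Tame.reach_rotate_neg {w : List ℤ} (h : Tame (w ++ [-1])) :
    Reach (defu (0 :: (w ++ [-1]))) (ofQDV (0 :: 0 :: w)) := by
  refine ⟨0 :: w, ⟨?_, ?_, ?_, ?_⟩, ?_, rfl⟩
  · exact slow_cons_cons.2 ⟨by norm_num, slow_dropLast h.slow⟩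
  · intro a ha
    rcases List.mem_cons.1 ha with rfl | ha
    · norm_num
    · exact h.ranged a (by simp [ha])
  · exact List.pairwise_cons.2 ⟨fun _ _ h => by norm_num at h, (List.pairwise_append.1 h.pw).1⟩
  · right; rfl
  · exact (defu_rotate_neg (h.ranged.sublist (by simp))).symm

theorem Tame.reach_rotate_one {w : List ℤ} (h : Tame (1 :: (w ++ [1])))
    (hw : SlowlyIncreasing (2 :: w)) :
    Reach (defu (0 :: 1 :: (w ++ [1]))) (ofQDV (0 :: 1 :: 2 :: w)) := by
  have hr : Ranged w := h.ranged.sublist (by simp)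
  refine ⟨1 :: 2 :: w, ⟨?_, ?_, ?_, ?_⟩, ?_, rfl⟩
  · exact slow_cons_cons.2 ⟨by norm_num, slow_cons_cons.2 ⟨by norm_num, hw⟩⟩
  · intro a ha
    rcases List.mem_cons.1 ha with rfl | ha
    · norm_num
    rcases List.mem_cons.1 ha with rfl | ha
    · norm_num
    · exact hr a ha
  · have := h.pw
    rw [List.pairwise_cons, List.pairwise_append] at this
    exact List.pairwise_cons.2 ⟨fun _ _ h => by norm_num at h,
      List.pairwise_cons.2 ⟨fun _ _ h => by norm_num at h, this.2.1⟩⟩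
  · left
    rcases h.start with hs | hs
    · simpa using hs
    · simp at hs
  · exact (defu_rotate_one hr).symm

/-- Without a -1, the rotated word 0 1 0 y fails the start condition of tameness. It is the raised
form of 0 (-1) followed by y lowered by 1, and that word is tame. -/
theorem Tame.reach_rotate_zero_zero {y : List ℤ} (h : Tame (0 :: (y ++ [0])))
    (hm : -1 ∉ 0 :: (y ++ [0])) :
    Reach (defu (0 :: 0 :: (y ++ [0]))) (ofQDV (0 :: 1 :: 0 :: y)) := by
  have hr : Ranged y := h.ranged.sublist (by simp)
  have hr0 : ∀ a ∈ y, 0 ≤ a := by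
    intro a ha
    have h1 := (hr a ha).1
    have h2 : a ≠ -1 := by rintro rfl; exact hm (by simp [ha])
    omega
  have hQ : IsQDV (0 :: 1 :: 0 :: y) :=
    isQDV_cons.2 ⟨rfl, slow_cons_one (w := 0 :: y) h.slow⟩
  have hup : 0 :: 1 :: 0 :: y = up (0 :: -1 :: y.map (· - 1)) := by
    simp [up, Function.comp_def]
  have hs : SlowlyIncreasing (0 :: -1 :: y.map (· - 1)) := by
    rw [← slow_map_add 1]
    have := hQ.2
    simp only [List.map_cons, List.map_map, Function.comp_def, sub_add_cancel, List.map_id']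
    exact (slow_cons_cons.1 this).2
  refine ⟨-1 :: y.map (· - 1), ⟨hs, ?_, ?_, ?_⟩, ?_, ?_⟩
  · intro a ha
    rcases List.mem_cons.1 ha with rfl | ha
    · norm_num
    · obtain ⟨b, hb, rfl⟩ := List.mem_map.1 ha
      have := hr b hb
      have := hr0 b hb
      omega
  · refine List.pairwise_cons.2 ⟨?_, List.pairwise_map.2 (List.pairwise_of_forall_mem_list ?_)⟩
    · intro a ha _
      obtain ⟨b, hb, rfl⟩ := List.mem_map.1 ha
      linarith [(hr b hb).2]
    · intro a ha b hb _
      linarith [(hr b hb).2]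
  · left; simp
  · have e : defu (0 :: -1 :: y.map (· - 1)) = defc (0 :: 1 :: 0 :: y) := by rw [defu, ← hup]
    rw [e, ← defu_of_nonneg (v := 0 :: 1 :: 0 :: y) (by simpa using hr0)]
    have := defu_rotate_zero (w := 0 :: y) (h.ranged.sublist (by simp))
    simpa using this.symm
  · rw [hup, ofQDV_up (isQDV_cons.2 ⟨rfl, hs⟩)]

/-- The representative ending in 0 is the tame word itself, or that word raised once (last entry
-1), or lowered once (last entry 1); each case is a rotation. Positivity of n excludes the word 0 0,
whose image is the zero partition, which has no tame word. -/
theorem Reach.nextDown1 {n : ℤ} {γ δ : IntPartition} (hn : 0 < n) (h : Reach n γ)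
    (hd : NextDown1 γ δ) : Reach n δ := by
  obtain ⟨x, hx, rfl, rfl⟩ := h
  obtain ⟨w, hw, e, rfl⟩ := nextDown1_iff.1 hd
  have hQw : IsQDV (0 :: (w ++ [0])) := isQDV_cons.2 ⟨rfl, hw⟩
  obtain ⟨x', a, rfl⟩ : ∃ x' a, x = x' ++ [a] := by
    rcases List.eq_nil_or_concat x with rfl | ⟨x', a, h⟩
    · exact absurd rfl hx.ne_nil
    · exact ⟨x', a, by simpa using h⟩
  have hra := hx.ranged a (by simp)
  have eq_case : 0 :: (x' ++ [a]) = 0 :: (w ++ [0]) →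
      Reach (defu (0 :: (x' ++ [a]))) (ofQDV (0 :: 1 :: w)) := by
    intro e
    obtain ⟨rfl, rfl⟩ : x' = w ∧ a = 0 := by simpa using e
    by_cases hm : -1 ∈ x' ++ [0]
    · exact hx.reach_rotate_zero hm
    · rcases hx.start with hs | hs
      · exact absurd hs hm
      · cases x' with
        | nil =>
          exfalso
          revert hn
          norm_num [defu_eq, defc_cons, nonInv]
        | cons b y =>
          obtain rfl : b = 0 := by simpa using hs
          exact hx.reach_rotate_zero_zero hm
  obtain ⟨k, hk⟩ := iterate_up_of_ofQDV_eq hx.isQDV hQw e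
  rcases hk with hk | hk
  · have hl := getLast?_iterate_up (getLast?_cons_concat 0 a x') k
    rw [← hk, getLast?_cons_concat] at hl
    have hl' : 0 = a + k := by simpa using hl
    obtain rfl | rfl : k = 0 ∨ k = 1 := by omega
    · exact eq_case hk.symm
    · obtain rfl : a = -1 := by push_cast at hl'; omega
      have e' : w = 1 :: x'.map (· + 1) := by
        have : w ++ [0] = (1 :: x'.map (· + 1)) ++ [0] := by simpa [up] using hk
        exact List.append_cancel_right this
      subst e'
      have := hx.reach_rotate_neg
      have hu : 0 :: 1 :: 1 :: x'.map (· + 1) = up (0 :: 0 :: x') := by simp [up]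
      rw [hu, ofQDV_up]
      · exact this
      · exact isQDV_cons.2 ⟨rfl, slow_cons_cons.2 ⟨by norm_num, slow_dropLast hx.slow⟩⟩
  · cases k with
    | zero => exact eq_case hk
    | succ k =>
      have hl := getLast?_iterate_up (getLast?_cons_concat 0 0 w) (k + 1)
      rw [← hk, getLast?_cons_concat] at hl
      have hl' : a = 0 + (k + 1 : ℕ) := by simpa using hl
      obtain ⟨y, hy⟩ := iterate_up_succ_eq _ hQw k
      rw [hy] at hk
      have hm : -1 ∈ x' ++ [a] := by
        rcases hx.start with hs | hs
        · exact hs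
        · rw [(List.cons_inj_right 0).1 hk] at hs
          simp at hs
      have := hx.last_le_one hm
      -- The tame word ends in k + 1, and by at most 1 because it contains -1.
      obtain rfl : k = 0 := by omega
      obtain rfl : a = 1 := by omega
      have hy' : y = w.map (· + 1) ++ [1] := by simpa [up] using hy.symm
      have e' : x' = 1 :: w.map (· + 1) := by
        have : x' ++ [1] = (1 :: w.map (· + 1)) ++ [1] := by
          rw [(List.cons_inj_right 0).1 hk, hy']; rfl
        exact List.append_cancel_right this
      subst e'
      have hs1 : SlowlyIncreasing (1 :: w) := (slow_cons_cons.1 (slow_cons_one hw)).2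
      have hs2 : SlowlyIncreasing (2 :: w.map (· + 1)) := by
        have := (slow_add_cons (c := 1)).2 hs1
        simpa using this
      have := hx.reach_rotate_one hs2
      have hu : 0 :: 1 :: 2 :: w.map (· + 1) = up (0 :: 1 :: w) := by simp [up]
      rw [hu, ofQDV_up (isQDV_cons.2 ⟨rfl, slow_cons_one hw⟩)] at this
      exact this

/-- A source starts with 0 0, so a different tame word of its class would be a raised form of it.
That form starts with 0 1, hence contains -1, yet it ends in at least 2. -/
theorem Tame.eq_src {x s : List ℤ} (hx : Tame x) (hs : IsQDV s)
    (hs' : ∃ y, s = 0 :: 0 :: (y ++ [1])) (e : ofQDV (0 :: x) = ofQDV s) : 0 :: x = s := by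
  obtain ⟨y, rfl⟩ := hs'
  have hl1 : (0 :: 0 :: (y ++ [1])).getLast? = some (1 : ℤ) := getLast?_cons_concat 0 1 (0 :: y)
  obtain ⟨k, hk⟩ := iterate_up_of_ofQDV_eq hx.isQDV hs e
  cases k with
  | zero => rcases hk with hk | hk <;> simpa [eq_comm] using hk
  | succ k =>
    exfalso
    rcases hk with hk | hk
    · obtain ⟨z, hz⟩ := iterate_up_succ_eq _ hx.isQDV k
      rw [hz] at hk; simp at hk
    · obtain ⟨x', a, rfl⟩ : ∃ x' a, x = x' ++ [a] := by
        rcases List.eq_nil_or_concat x with rfl | ⟨x', a, h⟩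
        · exact absurd rfl hx.ne_nil
        · exact ⟨x', a, by simpa using h⟩
      have hl := getLast?_iterate_up hl1 (k + 1)
      rw [← hk, getLast?_cons_concat] at hl
      have hl' : a = 1 + (k + 1 : ℕ) := by simpa using hl
      obtain ⟨z, hz⟩ := iterate_up_succ_eq _ hs k
      rw [hz] at hk
      have hm : -1 ∈ x' ++ [a] := by
        rcases hx.start with hs | hs
        · exact hs
        · rw [(List.cons_inj_right 0).1 hk] at hs
          simp at hs
      have := hx.last_le_one hm
      omega

theorem ranged_tgt {h m : ℕ} {A : List ℤ} (hA : Ranged A) :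
    Ranged (1 :: (List.replicate h 2 ++ A ++ List.replicate m (-1))) := by
  intro a ha
  simp only [List.mem_cons, List.mem_append, List.mem_replicate] at ha
  rcases ha with rfl | (⟨-, rfl⟩ | ha) | ⟨-, rfl⟩
  · norm_num
  · norm_num
  · exact hA a ha
  · norm_num

theorem pairwise_tgt {h m : ℕ} {A : List ℤ} (hA : A.Pairwise fun a b => a = -1 → b ≤ 1) :
    (1 :: (List.replicate h 2 ++ A ++ List.replicate m (-1))).Pairwise
      fun a b : ℤ => a = -1 → b ≤ 1 := by
  refine List.pairwise_cons.2 ⟨fun _ _ h => by norm_num at h, List.pairwise_append.2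
    ⟨List.pairwise_append.2 ⟨?_, hA, ?_⟩, ?_, ?_⟩⟩
  · exact List.pairwise_replicate.2 (.inr (by norm_num))
  · intro a ha b _ e
    rw [List.eq_of_mem_replicate ha] at e
    norm_num at e
  · exact List.pairwise_replicate.2 (.inr (by norm_num))
  · intro a _ b hb _
    rw [List.eq_of_mem_replicate hb]; norm_num

theorem Reach.nextUp2 {n : ℤ} {γ δ : IntPartition} (h : Reach n γ) (hd : NextUp2 δ γ) :
    Reach n δ := by
  obtain ⟨x, hx, rfl, rfl⟩ := h
  rcases nextUp2_iff.1 hd with ⟨h, A, c, rfl, e⟩ | ⟨k, B, c, rfl, e⟩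
  · have e' := hx.eq_src c.isQDV_src c.src_eq e
    have hh := c.two_le
    have hsub : A.Sublist x := by
      obtain ⟨h, rfl⟩ : ∃ m, h = m + 1 := ⟨h - 1, by omega⟩
      have : x = List.replicate h 0 ++ [1] ++ A ++ List.replicate (h + 1) 1 := by
        have := e'
        rw [srcA, List.replicate_succ] at this
        simpa using this
      rw [this, List.append_assoc _ A]
      exact (List.sublist_append_left _ _).trans (List.sublist_append_right _ _)
    refine ⟨1 :: (List.replicate h 2 ++ A ++ List.replicate (h - 1) (-1)),
      ⟨by simpa [tgtA, tgtB] using c.isQDV_tgt.2, ranged_tgt (hx.ranged.sublist hsub), pairwise_tgt (hx.pw.sublist hsub),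
        .inl ?_⟩, ?_, rfl⟩
    · simp; omega
    · rw [e', defu_srcA (hx.ranged.sublist hsub) (by omega)]
      rfl
  · have e' := hx.eq_src c.isQDV_src c.src_eq e
    have hh := c.one_le
    have hsub : B.Sublist x := by
      have : x = List.replicate k 0 ++ B ++ ([0] ++ List.replicate k 1) := by
        have := e'
        rw [srcB, List.replicate_succ] at this
        simpa using this
      rw [this, List.append_assoc _ B]
      exact (List.sublist_append_left _ _).trans (List.sublist_append_right _ _)
    refine ⟨1 :: (List.replicate k 2 ++ B ++ List.replicate k (-1)),
      ⟨by simpa [tgtA, tgtB] using c.isQDV_tgt.2, ranged_tgt (hx.ranged.sublist hsub), pairwise_tgt (hx.pw.sublist hsub),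
        .inl ?_⟩, ?_, rfl⟩
    · simp; omega
    · rw [e', defu_srcB (hx.ranged.sublist hsub)]
      rfl

theorem Reach.reflTransGen {n : ℤ} {γ δ : IntPartition} (hn : 0 < n) (h : Reach n γ)
    (hd : Relation.ReflTransGen NextDown γ δ) : Reach n δ := by
  induction hd with
  | refl => exact h
  | tail _ hs ih =>
    rcases hs with hs | hs
    · exact ih.nextDown1 hn hs
    · exact ih.nextUp2 hs

/-! ### Lower bounds for the deficit -/

theorem le_cross {l m : List ℤ} {a b : ℤ} (ha : a ∈ l) (hb : b ∈ m) : nonInv a b ≤ cross l m := by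
  obtain ⟨l1, l2, rfl⟩ := List.append_of_mem ha
  obtain ⟨m1, m2, rfl⟩ := List.append_of_mem hb
  have e : cross (l1 ++ a :: l2) (m1 ++ b :: m2) = cross l1 (m1 ++ b :: m2) +
      (cross [a] m1 + (cross [a] [b] + cross [a] m2) + cross l2 (m1 ++ b :: m2)) := by
    rw [cross_append_left, ← List.singleton_append (l := l2), cross_append_left [a],
      cross_append_right [a], ← List.singleton_append (l := m2), cross_append_right [a]]
  have h1 : cross [a] [b] = nonInv a b := by simp [cross]
  have := cross_nonneg l1 (m1 ++ b :: m2)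
  have := cross_nonneg [a] m1
  have := cross_nonneg [a] m2
  have := cross_nonneg l2 (m1 ++ b :: m2)
  linarith

/-- A slow ascent from a nonpositive entry to 2 has to pass through 1. -/
theorem one_mem_of_slow {U : List ℤ} : ∀ {a : ℤ}, a ≤ 0 → SlowlyIncreasing (a :: (U ++ [2])) →
    1 ∈ U := by
  induction U with
  | nil =>
    intro a ha h
    have := (slow_cons_cons.1 h).1
    linarith
  | cons b U ih =>
    intro a ha h
    rw [List.cons_append, slow_cons_cons] at h
    by_cases hb : b = 1
    · simp [hb]
    · exact List.mem_cons_of_mem _ (ih (a := b) (by omega) h.2)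

theorem row_eq_cross (a : ℤ) (l : List ℤ) : (l.map (nonInv a)).sum = cross [a] l := by simp [cross]

theorem defc_add_sum_nonneg (U : List ℤ) : 0 ≤ defc U + U.sum := by
  induction U with
  | nil => simp
  | cons a U ih =>
    have := cross_nonneg [a] U
    rw [← row_eq_cross] at this
    rw [defc_cons, List.sum_cons]
    linarith

/-- The right side is the number of pairs in U counted by `nonInv`. Every 2 forms such a pair with
an earlier 1. -/
theorem count_two_le {U : List ℤ} (hs : SlowlyIncreasing (0 :: U)) :
    (U.count 2 : ℤ) ≤ defc U + U.sum := by
  induction U using List.reverseRecOn with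
  | nil => simp
  | append_singleton U c ih =>
    have ih := ih (slow_dropLast hs)
    have h0 := cross_nonneg U [c]
    rw [defc_append, List.sum_append, List.count_append, defc_cons]
    simp only [defc_nil, List.map_nil, List.sum_nil, List.sum_cons]
    by_cases hc : c = 2
    · subst hc
      have := le_cross (one_mem_of_slow le_rfl hs) (List.mem_singleton.2 (rfl : (2 : ℤ) = 2))
      rw [nonInv_table.2.2.2.2.2.2.2.2.2.2.2.1] at this
      simp
      linarith
    · have : [c].count 2 = 0 := by simp [hc]
      rw [this]; push_cast
      linarith

/-- Dually, every 0 forms a counted pair with a later 1 on the ascent to the final 2. -/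
theorem count_zero_le {U : List ℤ} (hs : SlowlyIncreasing (U ++ [2])) :
    (U.count 0 : ℤ) ≤ defc U + U.sum := by
  induction U with
  | nil => simp
  | cons c U ih =>
    have ih := ih (slow_cons.1 hs).2
    have h0 := cross_nonneg [c] U
    rw [defc_cons, List.sum_cons, row_eq_cross]
    by_cases hc : c = 0
    · subst hc
      have := le_cross (List.mem_singleton.2 (rfl : (0 : ℤ) = 0)) (one_mem_of_slow le_rfl hs)
      rw [nonInv_table.2.2.2.2.2.2.1] at this
      simp
      linarith
    · rw [List.count_cons_of_ne hc]
      linarith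

theorem sum_eq_count {A : List ℤ} (h : Ranged A) :
    A.sum = -A.count (-1) + A.count 1 + 2 * A.count 2 := by
  have := sum_map_eq_count (fun x => x) h
  simp only [List.map_id'] at this
  linarith

theorem ranged_of_nonneg {A : List ℤ} (h : ∀ a ∈ A, 0 ≤ a ∧ a ≤ 2) :
    Ranged A ∧ A.count (-1) = 0 := by
  refine ⟨fun a ha => ⟨by linarith [(h a ha).1], (h a ha).2⟩, ?_⟩
  rw [List.count_eq_zero]
  intro hm
  linarith [(h _ hm).1]

/-- Against the outer letters, a 0 or a 1 of U contributes k + 1 ≥ 2. A 2 contributes only i ≥ 1,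
and `count_two_le` supplies the missing unit. -/
theorem bound_neg {i k : ℕ} {U : List ℤ} (hU : ∀ a ∈ U, 0 ≤ a ∧ a ≤ 2)
    (hs : SlowlyIncreasing (0 :: U)) (hi : 1 ≤ i) (hk : i ≤ k) :
    1 + (k : ℤ) * (i + 1) + 2 * U.length ≤
      defc (0 :: (List.replicate i 1 ++ 0 :: (U ++ 1 :: List.replicate k 2))) := by
  obtain ⟨hr, h0⟩ := ranged_of_nonneg hU
  have hQ := count_two_le hs
  rw [sum_eq_count hr, h0] at hQ
  simp only [defc_cons, defc_append, cross_cons_right, cross_append_right, cross_replicate_right,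
    cross_replicate_left, defc_replicate, List.map_append, List.map_replicate, List.sum_replicate,
    List.map_cons, List.sum_append, List.sum_cons, nsmul_eq_mul]
  simp only [sum_map_eq_count _ hr, nonInv_table]
  rw [length_eq_count hr, h0]
  push_cast at hQ ⊢
  have h1 : (1 : ℤ) ≤ i := by exact_mod_cast hi
  have h2 : (1 : ℤ) ≤ k := by exact_mod_cast hi.trans hk
  have h3 : (0 : ℤ) ≤ U.count 0 := by positivity
  have h4 : (0 : ℤ) ≤ U.count 1 := by positivity
  have h5 : (0 : ℤ) ≤ U.count 2 := by positivity
  nlinarith [mul_nonneg (sub_nonneg.2 h2) h3, mul_nonneg (sub_nonneg.2 h2) h4,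
    mul_nonneg (sub_nonneg.2 h1) h5]

/-- Against the outer letters, a 1 or a 2 of U contributes at least i - 1 ≥ 2. A 0 contributes k +
1, and `count_zero_le` supplies another unit. -/
theorem bound_zeros {i k : ℕ} {U : List ℤ} (hU : ∀ a ∈ U, 0 ≤ a ∧ a ≤ 2)
    (hs : SlowlyIncreasing (U ++ [2])) (hi : 3 ≤ i) :
    ((i : ℤ) - 1) * (k + 2) + 2 * U.length ≤
      defc (List.replicate i 0 ++ 1 :: (U ++ 2 :: List.replicate k 1)) := by
  obtain ⟨hr, h0⟩ := ranged_of_nonneg hU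
  have hQ := count_zero_le hs
  rw [sum_eq_count hr, h0] at hQ
  simp only [defc_cons, defc_append, cross_cons_right, cross_append_right, cross_replicate_right,
    cross_replicate_left, defc_replicate, List.map_append, List.map_replicate, List.sum_replicate,
    List.map_cons, List.sum_append, List.sum_cons, nsmul_eq_mul]
  simp only [sum_map_eq_count _ hr, nonInv_table]
  rw [length_eq_count hr, h0]
  push_cast at hQ ⊢
  have h1 : (3 : ℤ) ≤ i := by exact_mod_cast hi
  have h2 : (0 : ℤ) ≤ k := by positivity
  have h3 : (0 : ℤ) ≤ U.count 0 := by positivity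
  have h4 : (0 : ℤ) ≤ U.count 1 := by positivity
  have h5 : (0 : ℤ) ≤ U.count 2 := by positivity
  nlinarith [mul_nonneg h2 h3, mul_nonneg (sub_nonneg.2 h1) h4,
    mul_nonneg (sub_nonneg.2 h1) h5]

/-- The constant 3 just suffices: the length is 5 + k + |U| + |V|, and 3 + 8 > 2 · 5. Zeros of V
again need `count_zero_le`. -/
theorem bound_later_zero {k : ℕ} {U V : List ℤ} (hU : ∀ a ∈ U, 1 ≤ a ∧ a ≤ 2)
    (hV : ∀ a ∈ V, 0 ≤ a ∧ a ≤ 2) (hs : SlowlyIncreasing (V ++ [2])) :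
    3 + 2 * (k : ℤ) + 2 * U.length + 2 * V.length ≤
      defc (0 :: 0 :: 1 :: (U ++ 0 :: (V ++ 2 :: List.replicate k 1))) := by
  obtain ⟨hr, h0⟩ := ranged_of_nonneg hV
  obtain ⟨hr', h0'⟩ := ranged_of_nonneg fun a ha => ⟨by linarith [(hU a ha).1], (hU a ha).2⟩
  have h00 : U.count 0 = 0 := by
    rw [List.count_eq_zero]
    intro hm
    linarith [(hU _ hm).1]
  have hQ := count_zero_le hs
  have hQ' := defc_add_sum_nonneg U
  have hc := cross_nonneg U V
  rw [sum_eq_count hr, h0] at hQ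
  rw [sum_eq_count hr', h0'] at hQ'
  simp only [defc_cons, defc_append, cross_cons_right, cross_append_right, cross_replicate_right,
    defc_replicate, List.map_append, List.map_replicate, List.sum_replicate,
    List.map_cons, List.sum_append, List.sum_cons, nsmul_eq_mul]
  simp only [sum_map_eq_count _ hr, sum_map_eq_count _ hr', nonInv_table]
  rw [length_eq_count hr, length_eq_count hr', h0, h0', h00]
  push_cast at hQ hQ' ⊢
  have h2 : (0 : ℤ) ≤ k := by positivity
  have h3 : (0 : ℤ) ≤ V.count 0 := by positivity
  have h4 : (0 : ℤ) ≤ V.count 1 := by positivity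
  have h5 : (0 : ℤ) ≤ V.count 2 := by positivity
  have h6 : (0 : ℤ) ≤ U.count 1 := by positivity
  have h7 : (0 : ℤ) ≤ U.count 2 := by positivity
  nlinarith [mul_nonneg h2 h3]

theorem defc_zeros_ones (i k : ℕ) :
    defc (List.replicate i 0 ++ List.replicate k 1) = k * ((i : ℤ) - 1) := by
  rw [defc_append, defc_replicate, defc_replicate, cross_replicate_right]
  simp [nonInv_table]; ring

/-! ### Terminal objects -/

theorem exists_left_run {l : List ℤ} {a : ℤ} (h : ∃ b ∈ l, b ≠ a) :
    ∃ i c R, l = List.replicate i a ++ c :: R ∧ c ≠ a := by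
  induction l with
  | nil => simp at h
  | cons b l ih =>
    by_cases hb : b = a
    · subst hb
      obtain ⟨i, c, R, rfl, hc⟩ := ih (by
        obtain ⟨d, hd, hd'⟩ := h
        rcases List.mem_cons.1 hd with rfl | hd
        · exact absurd rfl hd'
        · exact ⟨d, hd, hd'⟩)
      exact ⟨i + 1, c, R, by simp [List.replicate_succ], hc⟩
    · exact ⟨0, b, l, by simp, hb⟩

theorem exists_right_run {l : List ℤ} {a : ℤ} (h : ∃ b ∈ l, b ≠ a) :
    ∃ k c X, l = X ++ c :: List.replicate k a ∧ c ≠ a := by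
  obtain ⟨k, c, X, e, hc⟩ := exists_left_run (l := l.reverse) (a := a) (by simpa using h)
  refine ⟨k, c, X.reverse, ?_, hc⟩
  have := congrArg List.reverse e
  simpa using this

/-- `γ` is in the domain of `ND`. -/
def HasNext (γ : IntPartition) : Prop := ∃ δ, NextDown γ δ

theorem CondA.hasNext {h : ℕ} {A : List ℤ} (c : CondA h A) : HasNext (ofQDV (srcA h A)) :=
  ⟨_, .inr (nextUp2_iff.2 (.inl ⟨h, A, c, rfl, rfl⟩))⟩

theorem CondB.hasNext {k : ℕ} {B : List ℤ} (c : CondB k B) : HasNext (ofQDV (srcB k B)) :=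
  ⟨_, .inr (nextUp2_iff.2 (.inr ⟨k, B, c, rfl, rfl⟩))⟩

theorem hasNext_of_last_zero {w : List ℤ} (h : SlowlyIncreasing (0 :: (w ++ [0]))) :
    HasNext (ofQDV (0 :: (w ++ [0]))) :=
  ⟨_, .inl (nextDown1_iff.2 ⟨w, h, rfl, rfl⟩)⟩

theorem hasNext_of_last_neg {w : List ℤ} (h : SlowlyIncreasing (0 :: (w ++ [-1]))) :
    HasNext (ofQDV (0 :: (w ++ [-1]))) := by
  have hQ : IsQDV (0 :: (w ++ [-1])) := isQDV_cons.2 ⟨rfl, h⟩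
  have e : up (0 :: (w ++ [-1])) = 0 :: ((1 :: w.map (· + 1)) ++ [0]) := by simp [up]
  have := hQ.up
  rw [e] at this
  rw [← ofQDV_up hQ, e]
  exact hasNext_of_last_zero this.2

theorem hasNext_of_ends_one {w : List ℤ} (h : SlowlyIncreasing (0 :: 1 :: (w ++ [1]))) :
    HasNext (ofQDV (0 :: 1 :: (w ++ [1]))) := by
  have e : up (0 :: (w.map (· - 1) ++ [0])) = 0 :: 1 :: (w ++ [1]) := by
    simp [up, Function.comp_def]
  have hs : SlowlyIncreasing (0 :: (w.map (· - 1) ++ [0])) := by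
    rw [← slow_map_add 1]
    have := (slow_cons_cons.1 h).2
    simpa [Function.comp_def] using this
  rw [← e, ofQDV_up (isQDV_cons.2 ⟨rfl, hs⟩)]
  exact hasNext_of_last_zero hs

/-- The i leading zeros are matched with the last i trailing ones; the surplus 1^{k-i} joins the
block A. -/
theorem hasNext_ruleA {i k : ℕ} {c : ℤ} {R v : List ℤ}
    (hv : v = List.replicate i 0 ++ 1 :: (R ++ c :: List.replicate k 1)) (hs : SlowlyIncreasing v)
    (h2 : ∀ a ∈ v, a ≤ 2) (hi : 2 ≤ i) (hik : i ≤ k) (hc : 0 ≤ c) : HasNext (ofQDV v) := by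
  have e : v = srcA i (R ++ c :: List.replicate (k - i) 1) := by
    rw [hv, srcA]
    simp [Nat.sub_add_cancel hik]
  have hsub : (R ++ c :: List.replicate (k - i) 1).Sublist v := by
    rw [e, srcA, List.append_assoc _ (R ++ _)]
    exact (List.sublist_append_left _ _).trans (List.sublist_append_right _ _)
  have hs' : SlowlyIncreasing (R ++ c :: List.replicate (k - i) 1) := by
    rw [e, srcA, List.append_assoc _ (R ++ _)] at hs
    exact (slow_append.1 (slow_append.1 hs).2.1).1
  rw [e]
  refine CondA.hasNext ⟨hi, hs', fun x hx => h2 x (hsub.subset hx), ?_⟩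
  intro x hx
  rw [List.getLast?_append, List.getLast?_cons, List.getLast?_replicate] at hx
  split_ifs at hx <;> simp at hx <;> omega

theorem hasNext_ruleA' {i k : ℕ} (hi : 2 ≤ i) (hik : i + 1 ≤ k) :
    HasNext (ofQDV (List.replicate i 0 ++ List.replicate k 1)) := by
  have e : List.replicate i (0 : ℤ) ++ List.replicate k 1 =
      srcA i (List.replicate (k - i - 1) 1) := by
    rw [srcA, List.append_assoc, List.append_assoc, ← List.replicate_one, ← List.replicate_add,
      ← List.replicate_add]
    congr 2; omega
  rw [e]
  refine CondA.hasNext ⟨hi, slow_replicate _ _, ?_, ?_⟩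
  · intro x hx
    rw [List.eq_of_mem_replicate hx]; norm_num
  · intro x hx
    rw [List.eq_of_mem_replicate (List.mem_of_getLast? hx)]; norm_num

/-- The rule uses k + 1 of the leading zeros; the surplus zeros join the block B. -/
theorem hasNext_ruleB {i k : ℕ} {R v : List ℤ}
    (hv : v = List.replicate i 0 ++ R ++ 0 :: List.replicate k 1) (hs : SlowlyIncreasing v)
    (hr : Ranged v) (hk : 1 ≤ k) (hik : k + 1 ≤ i) : HasNext (ofQDV v) := by
  have e : v = srcB k (List.replicate (i - (k + 1)) 0 ++ R) := by
    rw [hv, srcB, ← List.append_assoc, ← List.replicate_add, Nat.add_sub_cancel' hik]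
    simp
  have hsub : (List.replicate (i - (k + 1)) 0 ++ R).Sublist v := by
    rw [e, srcB, List.append_assoc _ _ (List.replicate k 1)]
    exact (List.sublist_append_right _ _).trans (List.sublist_append_left _ _)
  have hs' : SlowlyIncreasing (List.replicate (i - (k + 1)) 0 ++ R) ∧
      ∀ x ∈ (List.replicate (i - (k + 1)) 0 ++ R).head?, x ≤ 1 := by
    rw [e, srcB, List.append_assoc, slow_append, slow_append] at hs
    refine ⟨hs.1.2.1, fun x hx => ?_⟩
    have := hs.1.2.2 0 (by rw [List.getLast?_replicate, if_neg (by omega)]; rfl) x hx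
    linarith
  rw [e]
  exact CondB.hasNext ⟨hk, hs'.1, fun x hx => (hr x (hsub.subset hx)).2, hs'.2,
    fun x hx => (hr x (hsub.subset (List.mem_of_getLast? hx))).1⟩

theorem Tame.exists_concat {x : List ℤ} (hx : Tame x) (ht : ¬ HasNext (ofQDV (0 :: x))) :
    ∃ x' a, x = x' ++ [a] ∧ (a = 1 ∨ a = 2) := by
  rcases List.eq_nil_or_concat x with rfl | ⟨x', a, h⟩
  · exact absurd rfl hx.ne_nil
  rw [List.concat_eq_append] at h
  subst h
  refine ⟨x', a, rfl, ?_⟩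
  have hr := hx.ranged a (by simp)
  have h0 : a ≠ 0 := by
    rintro rfl
    exact ht (hasNext_of_last_zero hx.slow)
  have h1 : a ≠ -1 := by
    rintro rfl
    exact ht (hasNext_of_last_neg hx.slow)
  omega

theorem slow_run_zero_head {i : ℕ} {c : ℤ} {R : List ℤ} (hi : 1 ≤ i)
    (hs : SlowlyIncreasing (List.replicate i 0 ++ c :: R)) : c ≤ 1 := by
  have := (slow_append.1 hs).2.2 0 (by rw [List.getLast?_replicate, if_neg (by omega)]; rfl) c rfl
  linarith

/-- Terminality forces the form 0^i (-1) R 0 1^k with i ≤ k. After raising, the deficit is at least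
1 + k(i + 1) + 2|R|, while twice the length is only 2(i + k + 3 + |R|). -/
theorem not_flag_of_neg_mem {x : List ℤ} (hx : Tame x) (ht : ¬ HasNext (ofQDV (0 :: x)))
    (hm : -1 ∈ x) : 2 * (minTri (ofQDV (0 :: x)) : ℤ) < defu (0 :: x) + 8 := by
  obtain ⟨x', a, rfl, ha⟩ := hx.exists_concat ht
  have := hx.last_le_one hm
  obtain rfl : a = 1 := by omega
  have hr : Ranged (0 :: (x' ++ [1])) := by
    intro a ha
    rcases List.mem_cons.1 ha with rfl | ha
    · norm_num
    · exact hx.ranged a ha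
  have hpw : (0 :: (x' ++ [1])).Pairwise fun a b => a = -1 → b ≤ 1 :=
    List.pairwise_cons.2 ⟨fun _ _ h => by norm_num at h, hx.pw⟩
  have hhead : ∀ w, x' ≠ 1 :: w := by
    rintro w rfl
    exact ht (hasNext_of_ends_one hx.slow)
  obtain ⟨k, c', X, hX, hc'⟩ := exists_right_run (l := 0 :: (x' ++ [1])) (a := 1)
    ⟨0, by simp, by norm_num⟩
  have hs := hx.slow
  rw [hX] at hs hr hpw
  have hk : 1 ≤ k := by
    by_contra hk
    obtain rfl : k = 0 := by omega
    have := congrArg List.getLast? hX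
    rw [getLast?_cons_concat] at this
    simp at this
    exact hc' this.symm
  have hmv : -1 ∈ X ++ c' :: List.replicate k 1 := by
    rw [← hX]; simpa using hm
  have hc0 : 0 ≤ c' := by
    have := (slow_append.1 hs).2.1
    obtain ⟨k, rfl⟩ : ∃ m, k = m + 1 := ⟨k - 1, by omega⟩
    rw [List.replicate_succ, slow_cons_cons] at this
    linarith [this.1]
  have hmX : -1 ∈ X := by
    rcases List.mem_append.1 hmv with h | h
    · exact h
    · rcases List.mem_cons.1 h with h | h
      · omega
      · have := List.eq_of_mem_replicate h
        norm_num at this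
  have hc1 : c' ≤ 1 := (List.pairwise_append.1 hpw).2.2 _ hmX c' (by simp) rfl
  obtain rfl : c' = 0 := by omega
  obtain ⟨i, c, R, rfl, hc⟩ := exists_left_run (l := X) (a := 0) ⟨-1, hmX, by norm_num⟩
  have hi : 1 ≤ i := by
    by_contra hi
    obtain rfl : i = 0 := by omega
    simp at hX
    exact hc hX.1.symm
  have hcle : c ≤ 1 := by
    rw [List.append_assoc] at hs
    exact slow_run_zero_head hi hs
  have hcge : -1 ≤ c := (hr c (by simp)).1
  have hki : i ≤ k := by
    by_contra h
    exact ht (hasNext_ruleB hX hx.slow (hX ▸ hr) hk (by omega))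
  obtain rfl | rfl : c = 1 ∨ c = -1 := by omega
  · exfalso
    rcases hi.eq_or_lt with rfl | hi
    · rw [List.replicate_one] at hX
      have hX' : x' ++ [1] = 1 :: (R ++ 0 :: List.replicate k 1) := by simpa using hX
      cases x' with
      | nil =>
        simp at hX'
      | cons b w =>
        obtain rfl : b = 1 := by
          simp at hX'
          exact hX'.1
        exact hhead w rfl
    · exact ht (hasNext_ruleA (R := R) (c := 0) (by rw [hX]; simp) hx.slow
        (fun a ha => (hr a (hX ▸ ha)).2) hi hki le_rfl)
  · have hQ := hx.isQDV
    rw [hX] at hQ ⊢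
    set U := R.map (· + 1) with hU
    have hu : up (List.replicate i 0 ++ -1 :: R ++ 0 :: List.replicate k 1) =
        0 :: (List.replicate i 1 ++ 0 :: (U ++ 1 :: List.replicate k 2)) := by
      simp [up, hU]
    have hRr : ∀ a ∈ U, 0 ≤ a ∧ a ≤ 2 := by
      intro a ha
      obtain ⟨b, hb, rfl⟩ := List.mem_map.1 ha
      have h1 := (hr b (by simp [hb])).1
      rw [List.append_assoc, List.pairwise_append] at hpw
      have h2 := (List.pairwise_cons.1 hpw.2.1).1 b (by simp [hb]) rfl
      omega
    have hsU : SlowlyIncreasing (0 :: U) := by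
      have h1 : SlowlyIncreasing (-1 :: R) := (slow_append.1 (slow_append.1 hs).1).2.1
      have := (slow_add_cons (c := 1)).2 h1
      simpa [hU] using this
    have hb := bound_neg hRr hsU hi hki
    have hnn : ∀ a ∈ List.replicate i 1 ++ 0 :: (U ++ 1 :: List.replicate k 2), (0 : ℤ) ≤ a := by
      intro a ha
      simp only [List.mem_append, List.mem_cons, List.mem_replicate] at ha
      rcases ha with ⟨-, rfl⟩ | rfl | ha | rfl | ⟨-, rfl⟩
      · norm_num
      · norm_num
      · exact (hRr a ha).1
      · norm_num
      · norm_num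
    have hQu := hQ.up
    rw [hu] at hQu
    rw [← ofQDV_up hQ, defu, hu, minTri_ofQDV hQu hnn (by simp)]
    have h1 : (1 : ℤ) ≤ i := by exact_mod_cast hi
    have h2 : (i : ℤ) ≤ k := by exact_mod_cast hki
    simp only [List.length_append, List.length_cons, List.length_replicate]
    push_cast
    have h3 : ((i : ℤ) - 1) * i ≤ (i - 1) * k := by nlinarith
    -- That is, i² - 3i + 3 > 0, by completing the square.
    have h4 : 2 * (i : ℤ) < (i - 1) * i + 3 := by nlinarith [sq_nonneg (2 * (i : ℤ) - 3)]
    nlinarith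

/-- A -1 is already excluded, so the word is nonnegative, starts with 0 0, and min_Δ is its length.
Terminality leaves 0^i 1 R 2 1^k with k < i, or 0^{i+1} 1^k with i ≤ k ≤ i + 1. The deficit bounds
exclude i ≥ 3 and a 0 in R in the first form, and the second form entirely. -/
theorem terminal_form {x : List ℤ} (hx : Tame x) (ht : ¬ HasNext (ofQDV (0 :: x)))
    (hb : defu (0 :: x) + 8 ≤ 2 * (minTri (ofQDV (0 :: x)) : ℤ)) :
    ∃ U k, k ≤ 1 ∧ (∀ a ∈ U, 1 ≤ a ∧ a ≤ 2) ∧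
      0 :: x = 0 :: 0 :: 1 :: (U ++ 2 :: List.replicate k 1) := by
  have hm : -1 ∉ x := fun hm => by linarith [not_flag_of_neg_mem hx ht hm]
  have hs := hx.slow
  have hnn : ∀ a ∈ 0 :: x, 0 ≤ a ∧ a ≤ 2 := by
    intro a ha
    rcases List.mem_cons.1 ha with rfl | ha
    · norm_num
    · have := hx.ranged a ha
      have : a ≠ -1 := by rintro rfl; exact hm ha
      omega
  obtain ⟨hr, -⟩ := ranged_of_nonneg hnn
  have hx0 : x.head? = some 0 := hx.start.resolve_left hm
  rw [minTri_ofQDV hx.isQDV (fun a ha => (hnn a (by simp [ha])).1) (List.mem_of_head? hx0),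
    defu_of_nonneg fun a ha => (hnn a ha).1] at hb
  have hlen : ((x.length + 1 : ℕ) : ℤ) = ((0 :: x).length : ℕ) := by simp
  rw [hlen] at hb
  obtain ⟨x', a, hxa, ha⟩ := hx.exists_concat ht
  obtain ⟨k, c, X, hX, hc⟩ := exists_right_run (l := 0 :: x) (a := 1) ⟨0, by simp, by norm_num⟩
  rw [hX] at hs hnn hb
  have hk0 : c = 0 → 1 ≤ k := by
    rintro rfl
    by_contra hk
    obtain rfl : k = 0 := by omega
    rw [hxa] at hX
    have := congrArg List.getLast? hX
    rw [getLast?_cons_concat] at this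
    simp at this
    omega
  have hcr := hnn c (by simp)
  have hzz : ∃ y, 0 :: x = 0 :: 0 :: y := by
    cases x with
    | nil => simp at hx0
    | cons b y =>
      obtain rfl : b = 0 := by simpa using hx0
      exact ⟨y, rfl⟩
  obtain ⟨y, hy⟩ := hzz
  by_cases hX0 : ∃ b ∈ X, b ≠ 0
  · obtain ⟨i, d, R, rfl, hd⟩ := exists_left_run hX0
    rw [List.append_assoc] at hX hs hnn hb
    have hi : 1 ≤ i := by
      by_contra hi
      obtain rfl : i = 0 := by omega
      simp at hX
      exact hd hX.1.symm
    have hdr := hnn d (by simp)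
    obtain rfl : d = 1 := by
      have := slow_run_zero_head hi hs
      omega
    have hi2 : 2 ≤ i := by
      by_contra hi2
      obtain rfl : i = 1 := by omega
      rw [hy] at hX
      simp at hX
    obtain rfl | rfl : c = 0 ∨ c = 2 := by omega
    · exfalso
      have hk := hk0 rfl
      rcases le_or_gt i k with h | h
      · exact ht (hasNext_ruleA hX hx.slow (fun a ha => (hr a ha).2) hi2 h le_rfl)
      · exact ht (hasNext_ruleB (R := 1 :: R) (by rw [hX]; simp) hx.slow hr hk h)
    · have hki : k < i := by
        by_contra h
        exact ht (hasNext_ruleA hX hx.slow (fun a ha => (hr a ha).2) hi2 (by omega) (by norm_num))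
      have hRr : ∀ a ∈ R, 0 ≤ a ∧ a ≤ 2 := fun a ha => hnn a (by simp [ha])
      have hRs : SlowlyIncreasing (R ++ [2]) := by
        have h1 : SlowlyIncreasing (R ++ 2 :: List.replicate k 1) :=
          (slow_cons.1 (slow_append.1 hs).2.1).2
        rw [← List.singleton_append (l := List.replicate k 1), ← List.append_assoc] at h1
        exact (slow_append.1 h1).1
      simp only [List.length_append, List.length_cons, List.length_replicate, List.cons_append]
        at hb
      push_cast at hb
      obtain rfl : i = 2 := by
        by_contra hi3
        have := bound_zeros (k := k) hRr hRs (show 3 ≤ i by omega)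
        have h1 : (3 : ℤ) ≤ i := by exact_mod_cast (show 3 ≤ i by omega)
        have h2 : (0 : ℤ) ≤ k := by positivity
        nlinarith [mul_nonneg (sub_nonneg.2 h1) h2]
      refine ⟨R, k, by omega, ?_, by rw [hX]; rfl⟩
      by_cases h0 : (0 : ℤ) ∈ R
      · exfalso
        obtain ⟨U, V, rfl, hU0⟩ := List.eq_append_cons_of_mem h0
        have := bound_later_zero (k := k) (U := U) (V := V) (fun a ha => by
            have h1 := hRr a (by simp [ha])
            have : a ≠ 0 := by rintro rfl; exact hU0 ha
            omega) (fun a ha => hRr a (by simp [ha])) (by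
            rw [List.append_assoc] at hRs
            exact (slow_cons.1 (slow_append.1 hRs).2.1).2)
        have e : List.replicate 2 0 ++ 1 :: (U ++ 0 :: V ++ 2 :: List.replicate k 1) =
          0 :: 0 :: 1 :: (U ++ 0 :: (V ++ 2 :: List.replicate k (1 : ℤ))) := by
          simp [List.replicate_succ]
        rw [e] at hb
        simp only [List.length_append, List.length_cons] at hb
        push_cast at hb
        linarith
      · intro a ha
        have h1 := hRr a ha
        have : a ≠ 0 := by rintro rfl; exact h0 ha
        omega
  · exfalso
    push Not at hX0
    obtain ⟨i, hi⟩ : ∃ i, X = List.replicate i 0 := ⟨_, List.eq_replicate_of_mem hX0⟩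
    have hyX : (0 : ℤ) :: 0 :: y = List.replicate i 0 ++ c :: List.replicate k 1 := by
      rw [← hy, hX, hi]
    obtain rfl : c = 0 := by
      obtain rfl | rfl : c = 0 ∨ c = 2 := by omega
      · rfl
      · exfalso
        rcases Nat.eq_zero_or_pos i with rfl | h
        · simp at hyX
        · rw [hi] at hs
          have := slow_run_zero_head h hs
          norm_num at this
    have hk := hk0 rfl
    have hi1 : 1 ≤ i := by
      by_contra h
      obtain rfl : i = 0 := by omega
      obtain ⟨k, rfl⟩ : ∃ m, k = m + 1 := ⟨k - 1, by omega⟩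
      simp [List.replicate_succ] at hyX
    have e : X ++ 0 :: List.replicate k 1 = List.replicate (i + 1) 0 ++ List.replicate k 1 := by
      rw [hi, List.replicate_succ']; simp
    have h1 : i ≤ k := by
      by_contra h
      exact ht (hasNext_ruleB (i := i) (R := []) (by rw [hX, hi]; simp) hx.slow hr hk (by omega))
    have h2 : k ≤ i + 1 := by
      by_contra h
      rw [hX, e] at ht
      exact ht (hasNext_ruleA' (by omega) (by omega))
    -- The deficit is k · i and the length i + 1 + k, so both values of k give a quadratic in i
    -- without real roots.
    rw [e, defc_zeros_ones] at hb
    simp only [List.length_append, List.length_replicate] at hb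
    push_cast at hb
    have h3 : (i : ℤ) ≤ k := by exact_mod_cast h1
    have h4 : (k : ℤ) ≤ i + 1 := by exact_mod_cast h2
    obtain h5 | h5 : k = i ∨ k = i + 1 := by omega
    · subst h5
      nlinarith [sq_nonneg ((k : ℤ) - 2)]
    · subst h5
      push_cast at hb
      nlinarith [sq_nonneg (2 * (i : ℤ) - 3)]

/-! ### Block words and partitions -/

/-- The word `b (b+1)^{n₁} b (b+1)^{n₂} ⋯`. -/
def blockWord (b : ℤ) (ns : List ℕ) : List ℤ := ns.flatMap fun n => b :: List.replicate n (b + 1)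

@[simp] theorem blockWord_nil (b : ℤ) : blockWord b [] = [] := rfl

theorem blockWord_cons (b : ℤ) (n : ℕ) (ns : List ℕ) :
    blockWord b (n :: ns) = b :: (List.replicate n (b + 1) ++ blockWord b ns) := by
  simp [blockWord]

theorem blockWord_append (b : ℤ) (ns ms : List ℕ) :
    blockWord b (ns ++ ms) = blockWord b ns ++ blockWord b ms := by
  simp [blockWord]

theorem mem_blockWord {b a : ℤ} {ns : List ℕ} (h : a ∈ blockWord b ns) : a = b ∨ a = b + 1 := by
  simp only [blockWord, List.mem_flatMap, List.mem_cons, List.mem_replicate] at h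
  obtain ⟨_, _, h | h⟩ := h
  · exact .inl h
  · exact .inr h.2

theorem blockWord_head? {b : ℤ} {ns : List ℕ} : ∀ a ∈ (blockWord b ns).head?, a = b := by
  cases ns with
  | nil => simp
  | cons n ns =>
    rw [blockWord_cons]
    simp [eq_comm]

theorem replicate_append_blockWord_inj {b : ℤ} {n n' : ℕ} {ns ns' : List ℕ}
    (h : List.replicate n (b + 1) ++ blockWord b ns = List.replicate n' (b + 1) ++ blockWord b ns') :
    n = n' ∧ blockWord b ns = blockWord b ns' := by
  induction n generalizing n' with
  | zero =>
    cases n' with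
    | zero => exact ⟨rfl, by simpa using h⟩
    | succ n' =>
      have := blockWord_head? (b := b) (ns := ns) (b + 1) (by
        have h' : blockWord b ns = List.replicate (n' + 1) (b + 1) ++ blockWord b ns' := by
          simpa using h
        rw [h', List.replicate_succ]; rfl)
      linarith
  | succ n ih =>
    cases n' with
    | zero =>
      have := blockWord_head? (b := b) (ns := ns') (b + 1) (by
        have h' : blockWord b ns' = List.replicate (n + 1) (b + 1) ++ blockWord b ns := by
          simpa using h.symm
        rw [h', List.replicate_succ]; rfl)
      linarith
    | succ n' =>
      have := @ih n' (by simpa [List.replicate_succ] using h)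
      exact ⟨by omega, this.2⟩

theorem blockWord_injective (b : ℤ) : Function.Injective (blockWord b) := by
  intro ns
  induction ns with
  | nil =>
    intro ms h
    cases ms with
    | nil => rfl
    | cons m ms => simp [blockWord_cons] at h
  | cons n ns ih =>
    intro ms h
    cases ms with
    | nil => simp [blockWord_cons] at h
    | cons m ms =>
      rw [blockWord_cons, blockWord_cons, List.cons_inj_right] at h
      obtain ⟨rfl, h'⟩ := replicate_append_blockWord_inj h
      rw [ih h']

theorem exists_blockWord {b : ℤ} {w : List ℤ} (h : ∀ a ∈ w, a = b ∨ a = b + 1) :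
    ∃ n ns, w = List.replicate n (b + 1) ++ blockWord b ns := by
  induction w with
  | nil => exact ⟨0, [], rfl⟩
  | cons c w ih =>
    obtain ⟨n, ns, rfl⟩ := ih fun a ha => h a (by simp [ha])
    rcases h c (by simp) with rfl | rfl
    · exact ⟨0, n :: ns, by simp [blockWord_cons]⟩
    · exact ⟨n + 1, ns, by simp [List.replicate_succ]⟩

theorem exists_blockWord_of_head {b : ℤ} {w : List ℤ} (h : ∀ a ∈ w, a = b ∨ a = b + 1)
    (h0 : w.head? = some b) : ∃ n ns, w = blockWord b (n :: ns) := by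
  cases w with
  | nil => simp at h0
  | cons c w =>
    obtain rfl : c = b := by simpa using h0
    obtain ⟨n, ns, rfl⟩ := exists_blockWord (b := c) (w := w) fun a ha =>
      h a (List.mem_cons_of_mem _ ha)
    exact ⟨n, ns, (blockWord_cons _ _ _).symm⟩

/-- The last entry, if there is one, is nonzero. -/
def LastNonzero (ns : List ℕ) : Prop := ∀ m ∈ ns.getLast?, m ≠ 0

theorem lastNonzero_of_blockWord {b : ℤ} {ns : List ℕ}
    (h : ∀ a ∈ (blockWord b ns).getLast?, a = b + 1) : LastNonzero ns := by
  rintro m hm rfl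
  obtain ⟨ms, rfl⟩ := List.getLast?_eq_some_iff.1 hm
  rw [blockWord_append] at h
  have := h b (by simp [blockWord])
  linarith

theorem length_blockWord (b : ℤ) (ns : List ℕ) :
    (blockWord b ns).length = ns.length + ns.sum := by
  induction ns with
  | nil => rfl
  | cons n ns ih =>
    rw [blockWord_cons]
    simp only [List.length_cons, List.length_append, List.length_replicate, ih, List.sum_cons]
    omega

/-- The multiset with `ns[i]` copies of `i + 1`. -/
def multOfList (ns : List ℕ) : Multiset ℕ :=
  ∑ i ∈ Finset.range ns.length, Multiset.replicate (ns.getD i 0) (i + 1)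

theorem count_multOfList (ns : List ℕ) (i : ℕ) : (multOfList ns).count (i + 1) = ns.getD i 0 := by
  rw [multOfList, Multiset.count_sum']
  simp only [Multiset.count_replicate, add_left_inj]
  by_cases hi : i < ns.length
  · rw [Finset.sum_ite_eq']
    simp [hi]
  · rw [Finset.sum_ite_eq']
    simp [hi]

theorem mem_multOfList {ns : List ℕ} {m : ℕ} (h : m ∈ multOfList ns) : 1 ≤ m ∧ m ≤ ns.length := by
  rw [multOfList, Multiset.mem_sum] at h
  obtain ⟨i, hi, hm⟩ := h
  rw [Multiset.eq_of_mem_replicate hm]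
  have := Finset.mem_range.1 hi
  omega

/-- The sum `1 · ns[0] + 2 · ns[1] + ⋯`. -/
def weight (ns : List ℕ) : ℕ := (multOfList ns).sum

theorem weight_append_singleton (ns : List ℕ) (m : ℕ) :
    weight (ns ++ [m]) = weight ns + (ns.length + 1) * m := by
  unfold weight multOfList
  rw [List.length_append, List.length_singleton, Finset.sum_range_succ, Multiset.sum_add]
  congr 2
  · refine Finset.sum_congr rfl fun i hi => ?_
    rw [List.getD_append _ _ _ _ (Finset.mem_range.1 hi)]
  · simp [mul_comm]

@[simp] theorem weight_nil : weight [] = 0 := rfl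

/-- For the multiplicities of ν this is the hook bound ν₁ + ℓ(ν) ≤ |ν| + 1. -/
theorem length_add_sum_le {ns : List ℕ} (h : LastNonzero ns) :
    ns.length + ns.sum ≤ weight ns + 1 := by
  rcases List.eq_nil_or_concat ns with rfl | ⟨ms, m, rfl⟩
  · simp
  · rw [List.concat_eq_append] at h ⊢
    have hm : m ≠ 0 := h m (by simp)
    have key : ∀ l : List ℕ, l.sum ≤ weight l := by
      intro l
      induction l using List.reverseRecOn with
      | nil => simp
      | append_singleton l a ih =>
        rw [weight_append_singleton, List.sum_append, List.sum_singleton]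
        nlinarith [Nat.zero_le (l.length * a)]
    have := key ms
    rw [weight_append_singleton, List.length_append, List.sum_append, List.sum_singleton,
      List.length_singleton]
    have : ms.length ≤ ms.length * m := Nat.le_mul_of_pos_right _ (Nat.pos_of_ne_zero hm)
    nlinarith

/-! ### Partitions as multiplicity lists -/

namespace IntPartition

theorem part_zero_eq {γ : IntPartition} {r : ℕ} (h : ∀ x ∈ γ.2.parts, x ≤ r)
    (h0 : r = 0 ∨ r ∈ γ.2.parts) : γ.part 0 = r := by
  have hmem : ∀ x, x ∈ γ.2.parts ↔ x ∈ γ.sortedParts := by simp [sortedParts]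
  have hs := γ.sortedParts_pairwise
  unfold part
  simp only [hmem] at h h0
  cases hl : γ.sortedParts with
  | nil => rw [hl] at h0; simp at h0; simp [h0]
  | cons a l =>
    rw [hl] at h h0 hs
    have h1 := h a (by simp)
    have h2 : r ≤ a := by
      rcases h0 with rfl | h0
      · omega
      · rcases List.mem_cons.1 h0 with rfl | h0
        · exact le_rfl
        · exact (List.pairwise_cons.1 hs).1 r h0
    simp; omega

theorem le_part_zero {γ : IntPartition} {x : ℕ} (h : x ∈ γ.2.parts) : x ≤ γ.part 0 := by
  have hx : x ∈ γ.sortedParts := by simpa [sortedParts] using h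
  have hs := γ.sortedParts_pairwise
  unfold part
  cases hl : γ.sortedParts with
  | nil => rw [hl] at hx; simp at hx
  | cons a l =>
    rw [hl] at hx hs
    rcases List.mem_cons.1 hx with rfl | hx
    · simp
    · simpa using (List.pairwise_cons.1 hs).1 x hx

theorem part_zero_mem {γ : IntPartition} (h : γ.part 0 ≠ 0) : γ.part 0 ∈ γ.2.parts := by
  have hmem : ∀ x, x ∈ γ.2.parts ↔ x ∈ γ.sortedParts := by simp [sortedParts]
  rw [hmem]
  unfold part at h ⊢
  cases hl : γ.sortedParts with
  | nil => rw [hl] at h; simp at h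
  | cons a l => simp

/-- The list of multiplicities of `1, 2, …, γ₁` in `γ`. -/
def mults (γ : IntPartition) : List ℕ :=
  (List.range (γ.part 0)).map fun i => γ.2.parts.count (i + 1)

theorem parts_eq_multOfList (γ : IntPartition) : γ.2.parts = multOfList γ.mults := by
  ext a
  rcases Nat.eq_zero_or_pos a with rfl | ha
  · rw [Multiset.count_eq_zero.2, Multiset.count_eq_zero.2]
    · intro h; have := (mem_multOfList h).1; omega
    · intro h; exact absurd (γ.2.parts_pos h) (lt_irrefl _)
  · obtain ⟨i, rfl⟩ : ∃ i, a = i + 1 := ⟨a - 1, by omega⟩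
    rw [count_multOfList]
    by_cases hi : i < γ.part 0
    · simp [mults, hi]
    · rw [List.getD_eq_default _ _ (by simpa [mults] using hi), Multiset.count_eq_zero]
      intro h
      have := le_part_zero h
      omega

theorem mults_injective : Function.Injective mults := by
  intro γ δ h
  apply ext_parts
  rw [parts_eq_multOfList, parts_eq_multOfList δ, h]

theorem size_eq_weight (γ : IntPartition) : γ.size = weight γ.mults := by
  rw [weight, ← parts_eq_multOfList]
  exact γ.2.parts_sum.symm

theorem lastNonzero_mults (γ : IntPartition) : LastNonzero γ.mults := by
  intro m hm
  rcases Nat.eq_zero_or_pos (γ.part 0) with h | h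
  · simp [mults, h] at hm
  · obtain ⟨r, hr⟩ : ∃ r, γ.part 0 = r + 1 := ⟨γ.part 0 - 1, by omega⟩
    have hmem := part_zero_mem h.ne'
    rw [mults, hr, List.range_succ] at hm
    simp at hm
    rw [← hm, ← hr]
    exact (Multiset.count_pos.2 hmem).ne'

theorem exists_mults_eq {ns : List ℕ} (h : LastNonzero ns) : ∃ γ : IntPartition, γ.mults = ns := by
  let γ : IntPartition := ⟨_, ⟨multOfList ns, fun hi => (mem_multOfList hi).1, rfl⟩⟩
  have hp : γ.part 0 = ns.length := by
    apply part_zero_eq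
    · exact fun x hx => (mem_multOfList hx).2
    · rcases List.eq_nil_or_concat ns with hns | ⟨ms, m, hns⟩
      · left; simp [hns]
      · right
        rw [List.concat_eq_append] at hns
        have hm : m ≠ 0 := h m (by simp [hns])
        show ns.length ∈ multOfList ns
        have : (multOfList ns).count (ms.length + 1) = m := by
          rw [count_multOfList, hns]; simp
        have h2 : 0 < (multOfList ns).count (ms.length + 1) := by omega
        have h3 := Multiset.count_pos.1 h2
        simpa [hns] using h3
  refine ⟨γ, ?_⟩
  unfold mults
  rw [hp]
  apply List.ext_getElem
  · simp
  · intro i h1 h2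
    simp only [List.getElem_map, List.getElem_range]
    show (multOfList ns).count (i + 1) = _
    rw [count_multOfList, List.getD_eq_getElem _ _ h2]

theorem mults_eq_nil {γ : IntPartition} (h : γ.mults = []) : γ.size = 0 := by
  rw [size_eq_weight, h, weight_nil]

end IntPartition

theorem binWord_eq (μ : IntPartition) : binWord μ = blockWord 0 μ.mults := by
  simp [binWord, blockWord, mults, List.flatMap_map]

theorem tailInit_eq (μ : IntPartition) : tailInit μ = ofQDV (0 :: blockWord 0 μ.mults) := by
  rw [tailInit, binWord_eq]

/-! ### Deficits of block words -/

theorem sum_nonInv_blockWord_lower (b : ℤ) (ns : List ℕ) :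
    ((blockWord b ns).map (nonInv · b)).sum = 0 := by
  induction ns with
  | nil => rfl
  | cons n ns ih =>
    have h0 : nonInv (b + 1) b = 0 := by simp [nonInv]
    simp only [blockWord_cons, List.map_cons, List.map_append, List.map_replicate, List.sum_cons,
      List.sum_append, List.sum_replicate, ih, h0, nonInv_self]
    simp

theorem sum_nonInv_blockWord_upper (b : ℤ) (ns : List ℕ) :
    ((blockWord b ns).map (nonInv · (b + 1))).sum = ns.length := by
  induction ns with
  | nil => rfl
  | cons n ns ih =>
    have h1 : nonInv b (b + 1) = 1 := by simp [nonInv]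
    simp only [blockWord_cons, List.map_cons, List.map_append, List.map_replicate, List.sum_cons,
      List.sum_append, List.sum_replicate, ih, h1, nonInv_self, List.length_cons]
    push_cast; simp; ring

/-- A 1 in the i-th block forms counted pairs exactly with the i + 1 zeros before it. Subtracting
its value leaves i, the part that it encodes. -/
theorem defc_tailInit (ns : List ℕ) : defc (0 :: blockWord 0 ns) = weight ns := by
  induction ns using List.reverseRecOn with
  | nil => simp [defc]
  | append_singleton ns m ih =>
    rw [blockWord_append, ← List.cons_append, defc_append, ih, weight_append_singleton]
    have e : blockWord 0 [m] = 0 :: List.replicate m 1 := by simp [blockWord]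
    have h1 := sum_nonInv_blockWord_lower 0 ns
    have h2 := sum_nonInv_blockWord_upper 0 ns
    rw [zero_add] at h2
    rw [e, cross_cons_right, cross_replicate_right, defc_cons, defc_replicate]
    simp only [List.map_cons, List.sum_cons, h1, h2, List.map_replicate, List.sum_replicate,
      nonInv_table, nsmul_eq_mul]
    push_cast; ring

/-- Each 1 gains 2 from the leading zeros and loses its value. A 2 in the i-th block of `ns` also
pairs with the i + 1 ones before it and nets i + 1; a 2 of the block of a nets 1. -/
theorem defc_zero_zero_blockWord (a : ℕ) (ns : List ℕ) :
    defc (0 :: 0 :: blockWord 1 (a :: ns)) =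
      (blockWord 1 (a :: ns)).length + weight ns := by
  induction ns using List.reverseRecOn with
  | nil =>
    simp only [blockWord_cons, blockWord_nil, List.append_nil, defc_cons, defc_replicate,
      List.map_cons, List.sum_cons, List.map_replicate, List.sum_replicate, nsmul_eq_mul,
      List.length_cons, List.length_replicate, weight_nil, one_add_one_eq_two, nonInv_table]
    push_cast; ring
  | append_singleton ns m ih =>
    rw [← List.cons_append, blockWord_append, ← List.cons_append, ← List.cons_append, defc_append,
      ih, weight_append_singleton, List.length_append]
    have e : blockWord 1 [m] = 1 :: List.replicate m 2 := by simp [blockWord]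
    have h1 := sum_nonInv_blockWord_lower 1 (a :: ns)
    have h2 := sum_nonInv_blockWord_upper 1 (a :: ns)
    rw [one_add_one_eq_two] at h2
    rw [e, cross_cons_right, cross_replicate_right, defc_cons, defc_replicate]
    simp only [List.map_cons, List.sum_cons, h1, h2, List.map_replicate, List.sum_replicate,
      nonInv_table, nsmul_eq_mul, List.length_cons, List.length_replicate]
    push_cast; ring

/-- The vector `0 0 1 2^a 1 2^{n₁} 1 2^{n₂} ⋯` followed by `E`. -/
def blockVec (a : ℕ) (ns : List ℕ) (E : List ℤ) : List ℤ := 0 :: 0 :: (blockWord 1 (a :: ns) ++ E)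

theorem length_blockVec (a : ℕ) (ns : List ℕ) (k : ℕ) :
    (blockVec a ns (List.replicate k 1)).length = 3 + a + ns.length + ns.sum + k := by
  simp only [blockVec, List.length_cons, List.length_append, length_blockWord,
    List.length_replicate, List.sum_cons]
  ring

theorem defc_blockVec (a : ℕ) (ns : List ℕ) (k : ℕ) :
    defc (blockVec a ns (List.replicate k 1)) + 2 =
      (blockVec a ns (List.replicate k 1)).length + weight ns := by
  rw [blockVec, ← List.cons_append, ← List.cons_append, defc_append, defc_zero_zero_blockWord, defc_replicate,
    cross_replicate_right]
  have h1 := sum_nonInv_blockWord_lower 1 (a :: ns)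
  simp only [List.map_cons, List.sum_cons, h1, nonInv_table, List.length_append, List.length_cons,
    List.length_replicate]
  push_cast; ring

/-! ### Sequences of `ND₁`-steps on vectors -/

/-- `ND₁` leads from `[v]` to `[w]` if `v` is a quasi-Dyck vector, and then so is `w`. -/
def Leads (v w : List ℤ) : Prop :=
  IsQDV v → IsQDV w ∧ ReflTransGen NextDown1 (ofQDV v) (ofQDV w)

theorem Leads.refl (v : List ℤ) : Leads v v := fun h => ⟨h, .refl⟩

theorem Leads.trans {u v w : List ℤ} (h : Leads u v) (h' : Leads v w) : Leads u w := fun hu =>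
  ⟨(h' (h hu).1).1, (h hu).2.trans (h' (h hu).1).2⟩

theorem rotate_zero {w : List ℤ} (h : IsQDV (0 :: (w ++ [0]))) :
    IsQDV (0 :: 1 :: w) ∧ NextDown1 (ofQDV (0 :: (w ++ [0]))) (ofQDV (0 :: 1 :: w)) := by
  have hs := (isQDV_cons.1 h).2
  exact ⟨isQDV_cons.2 ⟨rfl, slow_cons_one hs⟩, nextDown1_iff.2 ⟨w, hs, rfl, rfl⟩⟩

theorem leads_rotate_zero (w : List ℤ) : Leads (0 :: (w ++ [0])) (0 :: 1 :: w) := fun h =>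
  ⟨(rotate_zero h).1, .single (rotate_zero h).2⟩

theorem leads_rotate_neg (w : List ℤ) : Leads (0 :: (w ++ [-1])) (0 :: 0 :: w) := by
  intro h
  have e1 : up (0 :: (w ++ [-1])) = 0 :: ((1 :: w.map (· + 1)) ++ [0]) := by simp [up]
  have e2 : up (0 :: 0 :: w) = 0 :: 1 :: 1 :: w.map (· + 1) := by simp [up]
  have hw : IsQDV (0 :: 0 :: w) := isQDV_cons.2
    ⟨rfl, slow_cons_cons.2 ⟨by norm_num, slow_dropLast (isQDV_cons.1 h).2⟩⟩
  refine ⟨hw, .single ?_⟩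
  rw [← ofQDV_up h, ← ofQDV_up hw, e1, e2]
  exact (rotate_zero (e1 ▸ h.up)).2

theorem Leads.up {v w : List ℤ} (h : Leads v w) (hv : IsQDV v) : Leads (up v) (up w) := fun _ =>
  ⟨(h hv).1.up, by rw [ofQDV_up hv, ofQDV_up (h hv).1]; exact (h hv).2⟩

theorem isQDV_of_up {w : List ℤ} (h : IsQDV (0 :: 1 :: w)) : IsQDV (0 :: w.map (· - 1)) := by
  refine isQDV_cons.2 ⟨rfl, ?_⟩
  rw [← slow_map_add 1]
  simpa [Function.comp_def] using (slow_cons_cons.1 (isQDV_cons.1 h).2).2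

theorem up_map_sub (w : List ℤ) : up (0 :: w.map (· - 1)) = 0 :: 1 :: w := by
  simp [up, Function.comp_def]

/-- Lowering all entries but the first two. -/
theorem leads_lower (w : List ℤ) : Leads (0 :: 1 :: w) (0 :: w.map (· - 1)) := fun h => by
  refine ⟨isQDV_of_up h, ?_⟩
  rw [← up_map_sub, ofQDV_up (isQDV_of_up h)]

theorem leads_rotate_one (w : List ℤ) : Leads (0 :: 1 :: (w ++ [1])) (0 :: 1 :: 2 :: w) := by
  intro h
  have h' := isQDV_of_up h
  have e : w.map (· - 1) ++ [(0 : ℤ)] = (w ++ [1]).map (· - 1) := by simp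
  have := (leads_rotate_zero (w.map (· - 1))).up (e ▸ h')
  rw [e, up_map_sub, show (1 : ℤ) :: w.map (· - 1) = (2 :: w).map (· - 1) by simp,
    up_map_sub] at this
  exact this h

theorem leads_rotate_ones (n : ℕ) (w : List ℤ) :
    Leads (0 :: 1 :: (w ++ List.replicate n 1)) (0 :: 1 :: (List.replicate n 2 ++ w)) := by
  induction n generalizing w with
  | zero => simpa using Leads.refl _
  | succ n ih =>
    have h1 := leads_rotate_one (w ++ List.replicate n 1)
    have h2 := ih (2 :: w)
    simpa [List.replicate_succ'] using h1.trans h2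

/-- Letters -1 and 0 are rotated from the end one by one and come back as 0 and 1. -/
theorem leads_rotate_lowered {E : List ℤ} (hE : ∀ e ∈ E, e = 0 ∨ e = 1) (w : List ℤ) :
    Leads (0 :: (w ++ E.map (· - 1))) (0 :: (E ++ w)) := by
  induction E using List.reverseRecOn generalizing w with
  | nil => simpa using Leads.refl _
  | append_singleton E e ih =>
    have h2 := ih (fun a ha => hE a (by simp [ha])) (e :: w)
    rw [List.map_append, ← List.append_assoc, List.append_assoc E]
    refine Leads.trans ?_ h2
    rcases hE e (by simp) with rfl | rfl
    · exact leads_rotate_neg _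
    · exact leads_rotate_zero _

/-- The last 0 returns as 1, and the n ones before it then return behind that 1 as 2s, so a final
1^n 0 becomes the block 1 2^n. -/
theorem leads_rotate_blocks (ns : List ℕ) (w : List ℤ) :
    Leads (0 :: (w ++ ns.flatMap fun n => List.replicate n 1 ++ [0])) (0 :: (blockWord 1 ns ++ w)) := by
  induction ns using List.reverseRecOn generalizing w with
  | nil => simpa using Leads.refl _
  | append_singleton ns n ih =>
    have h1 := leads_rotate_zero ((w ++ ns.flatMap fun n => List.replicate n 1 ++ [0]) ++
      List.replicate n 1)
    have h2 := leads_rotate_ones n (w ++ ns.flatMap fun n => List.replicate n 1 ++ [0])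
    have h3 := ih (1 :: (List.replicate n 2 ++ w))
    have := (h1.trans h2).trans (by simpa using h3)
    simpa [blockWord] using this

theorem blockWord_concat (b : ℤ) (ns : List ℕ) :
    blockWord b ns ++ [b] = b :: ns.flatMap fun n => List.replicate n (b + 1) ++ [b] := by
  induction ns with
  | nil => rfl
  | cons n ns ih => simp [blockWord_cons, ih]

theorem blockWord_map_sub (ns : List ℕ) : (blockWord 1 ns).map (· - 1) = blockWord 0 ns := by
  simp [blockWord, List.map_flatMap]

theorem slow_of_mem_range {b : ℤ} {l : List ℤ} (h : ∀ a ∈ l, b ≤ a ∧ a ≤ b + 1) :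
    SlowlyIncreasing l :=
  List.isChain_iff_getElem.2 fun i hi => by
    linarith [(h _ (List.getElem_mem (Nat.lt_of_succ_lt hi))).1, (h _ (List.getElem_mem hi)).2]

theorem isQDV_blockVec (a : ℕ) (ns : List ℕ) {E : List ℤ} (hE : ∀ e ∈ E, e = 0 ∨ e = 1) :
    IsQDV (blockVec a ns E) := by
  have h1 : SlowlyIncreasing (blockWord 1 (a :: ns)) := slow_of_mem_range (b := 1) fun x hx => by
    rcases mem_blockWord hx with rfl | rfl <;> norm_num
  have h2 : SlowlyIncreasing E := slow_of_mem_range (b := 0) fun x hx => by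
    rcases hE x hx with rfl | rfl <;> norm_num
  refine isQDV_cons.2 ⟨rfl, slow_cons_cons.2 ⟨by norm_num, ?_⟩⟩
  rw [slow_cons, slow_append]
  refine ⟨?_, h1, h2, ?_⟩
  · simp [blockWord_cons]
  · intro x hx y hy
    rcases hE y (List.mem_of_head? hy) with rfl | rfl <;>
    rcases mem_blockWord (List.mem_of_getLast? hx) with rfl | rfl <;> norm_num

/-- With W the block word of `n :: ns`, 0 Y the word W 1 lowered by 1, and E' the word E lowered by
1, ND₁ passes through 0 0 W 1 E 0, then 0 1 0 W 1 E (same class as 0 (-1) 0 Y E'), then 0 E (-1) 0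
Y, 0 W E (-1) 0, 0 1 W E (-1), and 0 0 1 W E. -/
theorem leads_blockVec (n : ℕ) (ns : List ℕ) {E : List ℤ} (hE : ∀ e ∈ E, e = 0 ∨ e = 1) :
    Leads (blockVec n ns (1 :: (E ++ [0]))) (blockVec 0 (n :: ns) E) := by
  set Y : List ℤ := (n :: ns).flatMap fun n => List.replicate n 1 ++ [0] with hY
  have hY' : (blockWord 1 (n :: ns) ++ [1]).map (· - 1) = 0 :: Y := by
    have := blockWord_concat 0 (n :: ns)
    rw [zero_add] at this
    rw [List.map_append, blockWord_map_sub, hY, ← this]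
    rfl
  have h1 : Leads (blockVec n ns (1 :: (E ++ [0])))
      (0 :: 1 :: 0 :: (blockWord 1 (n :: ns) ++ [1] ++ E)) := by
    have := leads_rotate_zero (0 :: (blockWord 1 (n :: ns) ++ [1] ++ E))
    simp only [List.append_assoc, List.cons_append, List.nil_append] at this ⊢
    exact this
  have h2 := leads_lower (0 :: (blockWord 1 (n :: ns) ++ [1] ++ E))
  rw [List.map_cons, List.map_append, hY'] at h2
  have h3 : Leads (0 :: (-1 :: 0 :: Y ++ E.map (· - 1))) (0 :: (E ++ (-1 :: 0 :: Y))) :=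
    leads_rotate_lowered hE _
  have h4 : Leads (0 :: (E ++ (-1 :: 0 :: Y)))
      (0 :: (blockWord 1 (n :: ns) ++ E ++ [-1] ++ [0])) := by
    have := leads_rotate_blocks (n :: ns) (E ++ [-1, 0])
    rw [← hY] at this
    simp only [List.append_assoc, List.cons_append, List.nil_append] at this ⊢
    exact this
  have h5 := leads_rotate_zero (blockWord 1 (n :: ns) ++ E ++ [-1])
  have h6 : Leads (0 :: 1 :: (blockWord 1 (n :: ns) ++ E ++ [-1])) (blockVec 0 (n :: ns) E) := by
    simpa [blockVec, blockWord_cons] using leads_rotate_neg (1 :: (blockWord 1 (n :: ns) ++ E))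
  exact h1.trans (h2.trans (h3.trans (h4.trans (h5.trans h6))))

theorem slow_of_append_append {l A r : List ℤ} (h : SlowlyIncreasing (l ++ A ++ r)) :
    SlowlyIncreasing A :=
  (slow_append.1 (slow_append.1 h).1).2.1

theorem Leads.reflTransGen {v w : List ℤ} (h : Leads v w) (hv : IsQDV v) :
    ReflTransGen NextDown (ofQDV v) (ofQDV w) :=
  ReflTransGen.mono (r := NextDown1) (p := NextDown) (fun _ _ h => Or.inl h) _ _ (h hv).2

theorem mem_blockWord_append {ns : List ℕ} {E : List ℤ} (hE : ∀ e ∈ E, e = 0 ∨ e = 1) {x : ℤ}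
    (hx : x ∈ blockWord 1 ns ++ E) : 0 ≤ x ∧ x ≤ 2 := by
  rcases List.mem_append.1 hx with hx | hx
  · rcases mem_blockWord hx with rfl | rfl <;> norm_num
  · rcases hE x hx with rfl | rfl <;> norm_num

/-- The first rule of ND₂ with h = 2, then a rotation: 0 0 1 A 1 1 goes to 0 1 2 2 A (-1), and then
to 0 0 1 2 2 A. -/
theorem reflTransGen_blockVec_add_two (a : ℕ) (ns : List ℕ) {E : List ℤ}
    (hE : ∀ e ∈ E, e = 0 ∨ e = 1) : ReflTransGen NextDown (ofQDV (blockVec a ns (E ++ [1, 1])))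
      (ofQDV (blockVec (a + 2) ns E)) := by
  set A : List ℤ := List.replicate a 2 ++ (blockWord 1 ns ++ E) with hA
  have hr : ∀ x ∈ A, 0 ≤ x ∧ x ≤ 2 := by
    intro x hx
    rcases List.mem_append.1 hx with hx | hx
    · rw [List.eq_of_mem_replicate hx]; norm_num
    · exact mem_blockWord_append hE hx
  have e : blockVec a ns (E ++ [1, 1]) = srcA 2 A := by
    simp [blockVec, srcA, hA, blockWord_cons, List.replicate_succ]
  have hQ : IsQDV (srcA 2 A) := e ▸ isQDV_blockVec a ns (by
    intro x hx
    rcases List.mem_append.1 hx with hx | hx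
    · exact hE x hx
    · simp at hx; exact .inr hx)
  have c : CondA 2 A := ⟨le_rfl, slow_of_append_append hQ.2, fun x hx => (hr x hx).2,
    fun x hx => (hr x (List.mem_of_getLast? hx)).1⟩
  have h1 : NextDown (ofQDV (srcA 2 A)) (ofQDV (tgtA 2 A)) :=
    .inr (nextUp2_iff.2 (.inl ⟨2, A, c, rfl, rfl⟩))
  have h2 : Leads (tgtA 2 A) (blockVec (a + 2) ns E) := by
    have := leads_rotate_neg (1 :: 2 :: 2 :: A)
    simpa [tgtA, blockVec, hA, blockWord_cons, List.replicate_succ] using this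
  rw [e]
  exact .head h1 (h2.reflTransGen c.isQDV_tgt)

/-- The second rule of ND₂ with k = 1, then a rotation: 0 0 B 0 1 goes to 0 1 2 B (-1), and then to
0 0 1 2 B. -/
theorem reflTransGen_blockVec_one (ns : List ℕ) {E : List ℤ} (hE : ∀ e ∈ E, e = 0 ∨ e = 1)  :
    ReflTransGen NextDown (ofQDV (0 :: 0 :: (blockWord 1 ns ++ E ++ [0, 1])))
      (ofQDV (blockVec 1 ns E)) := by
  have hr : ∀ x ∈ blockWord 1 ns ++ E, 0 ≤ x ∧ x ≤ 2 := fun x hx => mem_blockWord_append hE hx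
  have hQ := isQDV_blockVec 0 ns hE
  have hs : SlowlyIncreasing (1 :: (blockWord 1 ns ++ E)) := by
    simpa [blockVec, blockWord_cons] using (slow_cons.1 (slow_cons.1 (isQDV_cons.1 hQ).2).2).2
  have e : (0 : ℤ) :: 0 :: (blockWord 1 ns ++ E ++ [0, 1]) = srcB 1 (blockWord 1 ns ++ E) := by
    simp [srcB, List.replicate_succ]
  have c : CondB 1 (blockWord 1 ns ++ E) := by
    refine ⟨le_rfl, (slow_cons.1 hs).2, fun x hx => (hr x hx).2, ?_,
      fun x hx => by linarith [(hr x (List.mem_of_getLast? hx)).1]⟩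
    cases ns with
    | nil =>
      intro x hx
      rcases hE x (List.mem_of_head? hx) with rfl | rfl <;> norm_num
    | cons n ns => simp [blockWord_cons]
  have h1 : NextDown (ofQDV (srcB 1 (blockWord 1 ns ++ E))) (ofQDV (tgtB 1 (blockWord 1 ns ++ E))) :=
    .inr (nextUp2_iff.2 (.inr ⟨1, _, c, rfl, rfl⟩))
  have h2 : Leads (tgtB 1 (blockWord 1 ns ++ E)) (blockVec 1 ns E) := by
    have := leads_rotate_neg (1 :: 2 :: (blockWord 1 ns ++ E))
    simpa [tgtB, blockVec, blockWord_cons] using this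
  rw [e]
  exact .head h1 (h2.reflTransGen c.isQDV_tgt)

theorem exists_tailInit {x : List ℤ} (hx : ∀ e ∈ x, e = 0 ∨ e = 1) (h0 : x.head? = some 0)
    (h1 : ∀ e ∈ x.getLast?, e = 1) :
    ∃ μ : IntPartition, 0 < μ.size ∧ tailInit μ = ofQDV (0 :: x) := by
  obtain ⟨n, ns, rfl⟩ := exists_blockWord_of_head (b := 0) (by simpa using hx) h0
  have hl := lastNonzero_of_blockWord (b := 0) (by simpa using h1)
  obtain ⟨μ, hμ⟩ := exists_mults_eq hl
  refine ⟨μ, ?_, by rw [tailInit_eq, hμ]⟩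
  have h2 := length_add_sum_le hl
  obtain ⟨m, hm⟩ : ∃ m, (n :: ns).getLast? = some m := ⟨_, List.getLast?_cons⟩
  have h3 := List.single_le_sum (fun _ _ => Nat.zero_le _) m (List.mem_of_getLast? hm)
  have := hl m hm
  rw [size_eq_weight, hμ]
  simp only [List.length_cons] at h2
  omega

/-- Backwards, the 2s of the first block are traded in pairs for a final 1 1, a single one for a
final 0 1, and an empty first block is absorbed by `leads_blockVec`. The process ends at a binary
word; `hl` provides the final 1 that makes it a tail initiator. -/
theorem exists_reflTransGen_blockVec (ns : List ℕ) (hns : LastNonzero ns) (a : ℕ) (E : List ℤ)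
    (hE : ∀ e ∈ E, e = 0 ∨ e = 1) (hl : ns = [] → a = 0 → ∀ e ∈ E.getLast?, e = 1) :
    ∃ μ : IntPartition, 0 < μ.size ∧
      ReflTransGen NextDown (tailInit μ) (ofQDV (blockVec a ns E)) := by
  induction ns generalizing a E with
  | nil =>
    induction a using Nat.twoStepInduction generalizing E with
    | zero =>
      obtain ⟨μ, h1, h2⟩ := exists_tailInit (x := 0 :: 1 :: E) (by simpa using hE) rfl (by
        intro e he
        have := hl rfl rfl
        rw [List.getLast?_cons, List.getLast?_cons] at he
        cases hE' : E.getLast? with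
        | none => simpa [hE', eq_comm] using he
        | some b =>
          obtain rfl : b = e := by simpa [hE'] using he
          exact this b hE')
      exact ⟨μ, h1, by rw [h2]; exact .refl⟩
    | one =>
      obtain ⟨μ, h1, h2⟩ := exists_tailInit (x := 0 :: (E ++ [0, 1])) (by
        intro e he
        simp only [List.mem_cons, List.mem_append, List.not_mem_nil, or_false] at he
        have := hE e
        tauto) rfl (by simp [List.getLast?_cons])
      exact ⟨μ, h1, by rw [h2]; exact reflTransGen_blockVec_one [] hE⟩
    | more a ih _ =>
      obtain ⟨μ, h1, h2⟩ := ih (E ++ [1, 1]) (by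
        intro e he
        simp only [List.mem_cons, List.mem_append, List.not_mem_nil, or_false] at he
        have := hE e
        tauto) (by simp)
      exact ⟨μ, h1, h2.trans (reflTransGen_blockVec_add_two a [] hE)⟩
  | cons n ns ih =>
    have hns' : LastNonzero ns := by
      intro m hm
      exact hns m (by rw [List.getLast?_cons, hm]; rfl)
    induction a using Nat.twoStepInduction generalizing E with
    | zero =>
      have hE' : ∀ e ∈ 1 :: (E ++ [0]), e = 0 ∨ e = 1 := by
        intro e he
        simp only [List.mem_cons, List.mem_append, List.not_mem_nil, or_false] at he
        have := hE e
        tauto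
      obtain ⟨μ, h1, h2⟩ := ih hns' n (1 :: (E ++ [0])) hE' (by
        -- The appended 0 is harmless: the last multiplicity is nonzero, so more letters are
        -- appended before the base case.
        rintro rfl rfl
        exact absurd rfl (hns 0 rfl))
      exact ⟨μ, h1, h2.trans ((leads_blockVec n ns hE).reflTransGen (isQDV_blockVec _ _ hE'))⟩
    | one =>
      obtain ⟨μ, h1, h2⟩ := ih hns' n (E ++ [0, 1]) (by
        intro e he
        simp only [List.mem_cons, List.mem_append, List.not_mem_nil, or_false] at he
        have := hE e
        tauto) (by simp)
      refine ⟨μ, h1, h2.trans ?_⟩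
      have := reflTransGen_blockVec_one (n :: ns) hE
      rwa [List.append_assoc] at this
    | more a ih' _ =>
      obtain ⟨μ, h1, h2⟩ := ih' (E ++ [1, 1]) (by
        intro e he
        simp only [List.mem_cons, List.mem_append, List.not_mem_nil, or_false] at he
        have := hE e
        tauto) (by simp)
      exact ⟨μ, h1, h2.trans (reflTransGen_blockVec_add_two a (n :: ns) hE)⟩

/-! ### Distinct tail initiators have distinct orbits -/

/-- A full turn of ND₁: 0 0 E 0 goes to 0 1 0 E, which is the class of 0 (-1) followed by E lowered
by 1. Rotating the lowered letters gives 0 E (-1), and then 0 0 E. -/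
theorem transGen_drop_zero {E : List ℤ} (hE : ∀ e ∈ E, e = 0 ∨ e = 1) :
    TransGen NextDown1 (ofQDV (0 :: 0 :: (E ++ [0]))) (ofQDV (0 :: 0 :: E)) := by
  have hb : ∀ e ∈ 0 :: 0 :: (E ++ [0]), e = 0 ∨ e = 1 := by
    intro e he
    simp only [List.mem_cons, List.mem_append, List.not_mem_nil, or_false] at he
    have := hE e
    tauto
  have hQ : IsQDV (0 :: ((0 :: E) ++ [0])) := isQDV_cons.2
    ⟨rfl, slow_of_mem_range (b := 0) fun x hx => by rcases hb x hx with rfl | rfl <;> norm_num⟩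
  have h1 := rotate_zero hQ
  have h2 := leads_lower (0 :: E)
  have h3 : Leads (0 :: ([-1] ++ E.map (· - 1))) (0 :: (E ++ [-1])) := leads_rotate_lowered hE _
  have h4 := h2.trans (h3.trans (leads_rotate_neg E))
  exact .head' h1.2 (h4 h1.1).2

theorem exists_blockWord_eq (b : ℤ) {n : ℕ} {ns : List ℕ} (h : LastNonzero (n :: ns)) :
    ∃ x, blockWord b (n :: ns) = b :: (x ++ [b + 1]) := by
  rcases List.eq_nil_or_concat (List.replicate n (b + 1) ++ blockWord b ns) with h' | ⟨x, c, h'⟩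
  · exfalso
    rw [List.append_eq_nil_iff] at h'
    obtain ⟨h1, h2⟩ := h'
    cases ns with
    | nil => exact h n rfl (by simpa using h1)
    | cons m ns => simp [blockWord_cons] at h2
  · rw [List.concat_eq_append] at h'
    refine ⟨x, ?_⟩
    rw [blockWord_cons, h']
    obtain ⟨ms, m, hm⟩ := (List.eq_nil_or_concat (n :: ns)).resolve_left (by simp)
    rw [List.concat_eq_append] at hm
    have hm0 : m ≠ 0 := h m (by simp [hm])
    obtain ⟨m, rfl⟩ := Nat.exists_eq_succ_of_ne_zero hm0
    have e : blockWord b (n :: ns) = (blockWord b ms ++ b :: List.replicate m (b + 1)) ++ [b + 1] := by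
      rw [hm, blockWord_append, blockWord_cons, Nat.succ_eq_add_one, List.replicate_succ']
      simp
    rw [blockWord_cons, h', ← List.cons_append] at e
    have := (List.append_inj' e rfl).2
    rw [this]

theorem mults_ne_nil {μ : IntPartition} (h : 0 < μ.size) : μ.mults ≠ [] :=
  fun h' => h.ne' (mults_eq_nil h')

theorem exists_blockWord_mults {μ : IntPartition} (h : 0 < μ.size) :
    ∃ x, blockWord 0 μ.mults = 0 :: (x ++ [1]) := by
  have hl := lastNonzero_mults μ
  cases hm : μ.mults with
  | nil => exact absurd hm (mults_ne_nil h)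
  | cons n ns => exact exists_blockWord_eq 0 (hm ▸ hl)

theorem isQDV_tailInit (ns : List ℕ) : IsQDV (0 :: blockWord 0 ns) :=
  isQDV_cons.2 ⟨rfl, slow_of_mem_range (b := 0) fun x hx => by
    rcases List.mem_cons.1 hx with rfl | hx
    · norm_num
    · rcases mem_blockWord hx with rfl | rfl <;> norm_num⟩

theorem tailInit_injOn {μ μ' : IntPartition} (h : 0 < μ.size) (h' : 0 < μ'.size)
    (e : tailInit μ = tailInit μ') : μ = μ' := by
  obtain ⟨x, hx⟩ := exists_blockWord_mults h
  obtain ⟨x', hx'⟩ := exists_blockWord_mults h'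
  have hv := isQDV_tailInit μ.mults
  have hv' := isQDV_tailInit μ'.mults
  rw [tailInit_eq, tailInit_eq, hx, hx'] at e
  rw [hx] at hv
  rw [hx'] at hv'
  apply mults_injective
  apply blockWord_injective 0
  rw [hx, hx', eq_of_ofQDV_eq_of_start hv hv' e]

/-- TI(μ') = [0 0 x 1] ends arbitrarily long ND₁-chains, those from [0 0 x 1 0^t]. By injectivity of
ND every strict predecessor lies on them, so ND₁ applies to it. But ND₁ never applies to a word 0 0
⋯ 1, such as TI(μ). -/
theorem eq_of_reflTransGen_tailInit {μ μ' : IntPartition} (h : 0 < μ.size) (h' : 0 < μ'.size)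
    (hr : ReflTransGen NextDown (tailInit μ) (tailInit μ')) : μ = μ' := by
  obtain ⟨x', hx'⟩ := exists_blockWord_mults h'
  have hE : ∀ e ∈ x' ++ [1], e = 0 ∨ e = 1 := fun e he => by
    simpa using mem_blockWord (b := 0) (ns := μ'.mults) (hx' ▸ List.mem_cons_of_mem _ he)
  have hE' : ∀ t, ∀ e ∈ x' ++ [1] ++ List.replicate t 0, e = 0 ∨ e = 1 := by
    intro t e he
    rcases List.mem_append.1 he with he | he
    · exact hE e he
    · exact .inl (List.eq_of_mem_replicate he)
  have hstep : ∀ t, TransGen NextDown1 (ofQDV (0 :: 0 :: (x' ++ [1] ++ List.replicate (t + 1) 0)))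
      (ofQDV (0 :: 0 :: (x' ++ [1] ++ List.replicate t 0))) := by
    intro t
    rw [List.replicate_succ', ← List.append_assoc]
    exact transGen_drop_zero (hE' t)
  -- Each step backwards raises the threshold by one, so that the extra turn of the chain keeps the
  -- number of ND₁-steps positive.
  let P : IntPartition → Prop := fun δ => ∃ t0, ∀ t ≥ t0,
    TransGen NextDown1 (ofQDV (0 :: 0 :: (x' ++ [1] ++ List.replicate t 0))) δ
  have key : ∀ γ, ReflTransGen NextDown γ (tailInit μ') →
      P γ ∧ (γ = tailInit μ' ∨ ∃ δ, NextDown1 γ δ) := by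
    intro γ hr
    induction hr using ReflTransGen.head_induction_on with
    | refl =>
      refine ⟨⟨1, fun t ht => ?_⟩, .inl rfl⟩
      rw [tailInit_eq, hx']
      induction t, ht using Nat.le_induction with
      | base => simpa using hstep 0
      | succ t ht ih => exact (hstep t).trans ih
    | head hs _ ih =>
      obtain ⟨⟨t0, ht0⟩, -⟩ := ih
      have back : ∀ t ≥ t0, ∃ γ, ReflTransGen NextDown1
          (ofQDV (0 :: 0 :: (x' ++ [1] ++ List.replicate t 0))) γ ∧ NextDown1 γ _ := fun t ht =>
        TransGen.tail'_iff.1 (ht0 t ht)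
      refine ⟨⟨t0 + 1, fun t ht => ?_⟩, .inr ?_⟩
      · obtain ⟨t, rfl⟩ : ∃ s, t = s + 1 := ⟨t - 1, by omega⟩
        obtain ⟨γ, h1, h2⟩ := back t (by omega)
        rw [nextDown_left_unique hs (.inl h2)]
        exact (hstep t).trans_left h1
      · obtain ⟨γ, h1, h2⟩ := back t0 le_rfl
        rw [nextDown_left_unique hs (.inl h2)]
        exact ⟨_, h2⟩
  rcases (key _ hr).2 with e | ⟨δ, hδ⟩
  · exact tailInit_injOn h h' e
  · obtain ⟨x, hx⟩ := exists_blockWord_mults h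
    have hv := isQDV_tailInit μ.mults
    rw [tailInit_eq, hx] at hδ
    rw [hx] at hv
    exact absurd hδ (not_nextDown1_of_start one_pos hv δ)

/-- The reversed relation is single-valued, so of two ancestors of γ one is reached from the other.
-/
theorem eq_of_common_reflTransGen {μ μ' γ : IntPartition} (h : 0 < μ.size) (h' : 0 < μ'.size)
    (hr : ReflTransGen NextDown (tailInit μ) γ) (hr' : ReflTransGen NextDown (tailInit μ') γ) :
    μ = μ' := by
  have hu : Relator.RightUnique (Function.swap NextDown) := fun _ _ _ h h' =>
    nextDown_left_unique h h'
  rcases ReflTransGen.total_of_right_unique hu (reflTransGen_swap.2 hr) (reflTransGen_swap.2 hr')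
    with h1 | h1
  · exact (eq_of_reflTransGen_tailInit h' h (reflTransGen_swap.1 h1)).symm
  · exact eq_of_reflTransGen_tailInit h h' (reflTransGen_swap.1 h1)

theorem IsTailInit2.unique {μ γ γ' : IntPartition} (h : IsTailInit2 μ γ) (h' : IsTailInit2 μ γ') :
    γ = γ' := by
  have hu : Relator.RightUnique NextDown := fun _ _ _ h h' => nextDown_right_unique h h'
  have eq_of_terminal : ∀ {γ γ' : IntPartition}, (∀ δ, ¬ NextDown γ δ) → ReflTransGen NextDown γ γ' → γ = γ' := by
    intro γ γ' h1 h2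
    rcases h2.cases_head with e | ⟨δ, h3, -⟩
    · exact e
    · exact absurd h3 (h1 δ)
  rcases ReflTransGen.total_of_right_unique hu h.1 h'.1 with h1 | h1
  · exact eq_of_terminal h.2 h1
  · exact (eq_of_terminal h'.2 h1).symm

theorem reach_tailInit {μ : IntPartition} (h : 0 < μ.size) : Reach μ.size (tailInit μ) := by
  obtain ⟨x, hx⟩ := exists_blockWord_mults h
  have hm : ∀ a ∈ blockWord 0 μ.mults, a = 0 ∨ a = 1 := fun a ha => by simpa using mem_blockWord ha
  refine ⟨blockWord 0 μ.mults, ⟨(isQDV_tailInit _).2, ?_, ?_, ?_⟩, ?_, tailInit_eq μ⟩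
  · intro a ha
    rcases hm a ha with rfl | rfl <;> norm_num
  · exact List.Pairwise.imp_of_mem (R := fun _ _ => True)
      (fun {a b} _ hb _ _ => by rcases hm b hb with rfl | rfl <;> norm_num)
      (List.pairwise_of_forall fun _ _ => trivial)
  · right; rw [hx]; rfl
  · rw [defu_of_nonneg, defc_tailInit, ← size_eq_weight]
    intro a ha
    rcases List.mem_cons.1 ha with rfl | ha
    · exact le_rfl
    · rcases hm a ha with rfl | rfl <;> norm_num

/-! ### Terminal vectors -/

/-- The 2 stops the trailing ones at k ≤ 1. The first rule needs at least two of them; the second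
could only use one, preceded by 0 instead of 2. -/
theorem not_nextDown_terminal {U : List ℤ} {k : ℕ} (hk : k ≤ 1)
    (hv : IsQDV (0 :: 0 :: (U ++ 2 :: List.replicate k 1))) (δ : IntPartition) :
    ¬ NextDown (ofQDV (0 :: 0 :: (U ++ 2 :: List.replicate k 1))) δ := by
  rintro (h | h)
  · obtain rfl | rfl : k = 0 ∨ k = 1 := by omega
    · exact not_nextDown1_of_start two_pos hv δ h
    · have e : U ++ 2 :: List.replicate 1 (1 : ℤ) = (U ++ [2]) ++ [1] := by simp
      rw [e] at h hv
      exact not_nextDown1_of_start one_pos hv δ h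
  · rcases nextUp2_iff.1 h with ⟨h, A, c, -, e⟩ | ⟨m, B, c, -, e⟩
    · obtain ⟨y, hy⟩ := c.src_eq
      have hQ := c.isQDV_src
      have e' : 0 :: 0 :: (U ++ 2 :: List.replicate k 1) = srcA h A := by
        rw [hy] at e hQ ⊢
        rw [eq_of_ofQDV_eq_of_start hv hQ e]
      rw [srcA, ← List.cons_append, ← List.cons_append] at e'
      have := run_le_right e' (by norm_num)
      have := c.two_le
      omega
    · obtain ⟨y, hy⟩ := c.src_eq
      have hQ := c.isQDV_src
      have e' : 0 :: 0 :: (U ++ 2 :: List.replicate k 1) = srcB m B := by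
        rw [hy] at e hQ ⊢
        rw [eq_of_ofQDV_eq_of_start hv hQ e]
      have e2 := e'
      rw [srcB, ← List.cons_append, ← List.cons_append] at e2
      have h1 := run_le_right e2 (by norm_num)
      have := c.one_le
      obtain rfl : k = 1 := by omega
      obtain rfl : m = 1 := by omega
      have := congrArg List.reverse e2
      simp at this

theorem blockVec_inj {a a' k k' : ℕ} {ns ns' : List ℕ} (h : LastNonzero (a :: ns))
    (h' : LastNonzero (a' :: ns'))
    (e : ofQDV (blockVec a ns (List.replicate k 1)) = ofQDV (blockVec a' ns' (List.replicate k' 1))) :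
    ns = ns' ∧ k = k' := by
  have hb : ∀ k : ℕ, ∀ e ∈ List.replicate k (1 : ℤ), e = 0 ∨ e = 1 := fun k e he =>
    .inr (List.eq_of_mem_replicate he)
  have e1 := eq_of_ofQDV_eq_of_start (isQDV_blockVec a ns (hb k)) (isQDV_blockVec a' ns' (hb k')) e
  obtain ⟨x, hx⟩ := exists_blockWord_eq 1 h
  obtain ⟨x', hx'⟩ := exists_blockWord_eq 1 h'
  have e2 := e1
  rw [hx, hx', ← List.cons_append, ← List.cons_append, List.append_assoc, List.append_assoc,
    List.singleton_append, List.singleton_append] at e2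
  have k1 := run_le_right (m := k') (Y := 1 :: x' ++ [2]) (e2.trans (by simp)) (by norm_num)
  have k2 := run_le_right (m := k) (Y := 1 :: x ++ [2]) (e2.symm.trans (by simp))
    (by norm_num)
  obtain rfl : k = k' := by omega
  have := blockWord_injective 1 (List.append_cancel_right e1)
  exact ⟨(List.cons.inj this).2, rfl⟩

theorem minTri_blockVec (a k : ℕ) (ns : List ℕ) :
    minTri (ofQDV (blockVec a ns (List.replicate k 1))) = 3 + a + ns.length + ns.sum + k := by
  rw [← length_blockVec]
  have hb : ∀ e ∈ List.replicate k (1 : ℤ), e = 0 ∨ e = 1 := fun e he =>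
    .inr (List.eq_of_mem_replicate he)
  refine minTri_ofQDV (isQDV_blockVec a ns hb) ?_ (by simp)
  intro x hx
  rcases List.mem_cons.1 hx with rfl | hx
  · exact le_rfl
  · exact (mem_blockWord_append hb hx).1

/-! ### Flagpole partitions and their second-order tail initiators -/

/-- The vector of length `n + 2 - |ν|` that represents the second-order tail initiator attached to
`ν` and `k`. -/
def flagVec (n : ℕ) (ν : IntPartition) (k : ℕ) : List ℤ :=
  blockVec (n - (ν.size + k + 1 + ν.mults.length + ν.mults.sum)) ν.mults (List.replicate k 1)

/-- By the hook bound the subtraction in `flagVec` is not truncated and its first block contains at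
least one 2. -/
theorem flagVec_bound {n k : ℕ} {ν : IntPartition} (hk : k ≤ 1) (h : 2 * ν.size + 4 ≤ n) :
    ν.size + k + 1 + ν.mults.length + ν.mults.sum < n := by
  have := length_add_sum_le (lastNonzero_mults ν)
  rw [← size_eq_weight] at this
  omega

theorem LastNonzero.cons {a : ℕ} {ns : List ℕ} (ha : a ≠ 0) (h : LastNonzero ns) :
    LastNonzero (a :: ns) := by
  intro m hm
  rw [List.getLast?_cons] at hm
  cases h' : ns.getLast? with
  | none => rw [h'] at hm; cases hm; exact ha
  | some b => rw [h'] at hm; cases hm; exact h _ h'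

theorem nonneg_of_mem_blockVec {a k : ℕ} {ns : List ℕ} {x : ℤ}
    (hx : x ∈ blockVec a ns (List.replicate k 1)) : 0 ≤ x := by
  simp only [blockVec, List.mem_cons] at hx
  rcases hx with rfl | rfl | hx
  · exact le_rfl
  · exact le_rfl
  · exact (mem_blockWord_append (fun e he => .inr (List.eq_of_mem_replicate he)) hx).1

theorem Tame.defu_eq_of_ofQDV_eq {x w : List ℤ} (hx : Tame x) (hw : IsQDV w)
    (h0 : ∀ a ∈ w, 0 ≤ a) (h : ofQDV (0 :: x) = ofQDV w) : defu (0 :: x) = defc w := by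
  refine defc_eq_of_ofQDV_eq hx.isQDV.up hw ((ofQDV_up hx.isQDV).trans h) ?_ h0
  intro a ha
  rcases List.mem_cons.1 ha with rfl | ha
  · exact le_rfl
  · obtain ⟨b, hb, rfl⟩ := List.mem_map.1 ha
    rcases List.mem_cons.1 hb with rfl | hb
    · norm_num
    · linarith [(hx.ranged b hb).1]

theorem exists_isTailInit2_flagVec {n k : ℕ} {ν : IntPartition} (hk : k ≤ 1)
    (h : 2 * ν.size + 4 ≤ n) : ∃ μ : n.Partition,
      IsFlagpole ⟨n, μ⟩ ∧ IsTailInit2 ⟨n, μ⟩ (ofQDV (flagVec n ν k)) := by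
  have hlt := flagVec_bound hk h
  set a := n - (ν.size + k + 1 + ν.mults.length + ν.mults.sum) with ha
  have hb : ∀ e ∈ List.replicate k (1 : ℤ), e = 0 ∨ e = 1 := fun e he =>
    .inr (List.eq_of_mem_replicate he)
  have hQ := isQDV_blockVec a ν.mults hb
  have hl := lastNonzero_mults ν
  obtain ⟨⟨m, μ⟩, hμ, hr⟩ := exists_reflTransGen_blockVec ν.mults hl a
    (List.replicate k 1) hb (fun _ h => by omega)
  have hd := defc_blockVec a ν.mults k
  rw [← size_eq_weight, length_blockVec] at hd
  -- The size of the tail partition found is the invariant deficit, and a was chosen to make that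
  -- deficit n.
  have hm : m = n := by
    obtain ⟨x, hx, hdef, he⟩ := (reach_tailInit hμ).reflTransGen (by exact_mod_cast hμ) hr
    have := hx.defu_eq_of_ofQDV_eq hQ (fun _ => nonneg_of_mem_blockVec) he.symm
    rw [hdef] at this
    have hmm : IntPartition.size ⟨m, μ⟩ = m := rfl
    rw [hmm] at this
    omega
  subst hm
  have hterm : ∀ δ, ¬ NextDown (ofQDV (blockVec a ν.mults (List.replicate k 1))) δ := by
    obtain ⟨x, hx⟩ := exists_blockWord_eq 1 (LastNonzero.cons (a := a) (by omega) hl)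
    have e : blockVec a ν.mults (List.replicate k 1) =
        0 :: 0 :: ((1 :: x) ++ 2 :: List.replicate k 1) := by
      rw [blockVec, hx]; simp
    rw [e] at hQ ⊢
    exact not_nextDown_terminal hk hQ
  refine ⟨μ, ⟨_, ⟨hr, hterm⟩, ?_⟩, hr, hterm⟩
  rw [minTri_blockVec]
  show m + 8 ≤ _
  omega

/-- Size 0 needs separate treatment, since the invariant requires a positive deficit. Here TI(μ) is
the zero partition, ND is undefined there, and min_Δ is at most 1. -/
theorem not_isFlagpole_of_size_eq_zero {μ : IntPartition} (h : μ.size = 0) : ¬ IsFlagpole μ := by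
  rintro ⟨γ, ⟨hr, -⟩, hb⟩
  have hm : μ.mults = [] := by
    by_contra hne
    have h0 : μ.part 0 ≠ 0 := fun h0 => hne (by simp [mults, h0])
    have h1 : 0 < μ.part 0 := by omega
    have h2 := μ.2.parts_sum
    have h3 := Multiset.single_le_sum (fun _ _ => Nat.zero_le _) _ (part_zero_mem h0)
    have : μ.1 = 0 := h
    omega
  have hQ : IsQDV [0] := isQDV_cons.2 ⟨rfl, slow_replicate 1 0⟩
  rw [tailInit_eq, hm, blockWord_nil] at hr
  have no : ∀ y, IsQDV (0 :: 0 :: (y ++ [1])) → ofQDV [0] ≠ ofQDV (0 :: 0 :: (y ++ [1])) := by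
    intro y hy e
    obtain ⟨k, hk⟩ := iterate_up_of_ofQDV_eq hQ hy e
    cases k with
    | zero => simp at hk
    | succ k =>
      rcases hk with hk | hk
      · obtain ⟨x, hx⟩ := iterate_up_succ_eq _ hQ k
        rw [hx] at hk; simp at hk
      · obtain ⟨x, hx⟩ := iterate_up_succ_eq _ hy k
        rw [hx] at hk; simp at hk
  have hlen := (qdv_ofQDV _ hQ).1
  have hγ : ofQDV [0] = γ := by
    rcases hr.cases_head with e | ⟨δ, h1 | h1, -⟩
    · exact e
    · have := h1.1
      simp only [List.length_singleton] at hlen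
      omega
    · exfalso
      rcases nextUp2_iff.1 h1 with ⟨h, A, c, -, e⟩ | ⟨k, B, c, -, e⟩
      · obtain ⟨y, hy⟩ := c.src_eq
        exact no y (hy ▸ c.isQDV_src) (hy ▸ e)
      · obtain ⟨y, hy⟩ := c.src_eq
        exact no y (hy ▸ c.isQDV_src) (hy ▸ e)
  have : minTri γ ≤ 1 := by
    rw [← hγ]
    refine Nat.sInf_le ⟨hlen, ?_⟩
    have := (qdv_ofQDV _ hQ).2
    rw [List.length_singleton] at this
    rw [this]
    simp
  omega

theorem exists_flagVec {n : ℕ} {μ : n.Partition} (h : IsFlagpole ⟨n, μ⟩) :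
    ∃ (ν : IntPartition) (k : ℕ), k ≤ 1 ∧ 2 * ν.size + 4 ≤ n ∧
      IsTailInit2 ⟨n, μ⟩ (ofQDV (flagVec n ν k)) := by
  have hpos : 0 < IntPartition.size ⟨n, μ⟩ := Nat.pos_of_ne_zero fun h0 =>
    not_isFlagpole_of_size_eq_zero h0 h
  obtain ⟨γ, ht, hb⟩ := h
  obtain ⟨x, hx, hdef, rfl⟩ := (reach_tailInit hpos).reflTransGen (by exact_mod_cast hpos) ht.1
  have hsz : IntPartition.size ⟨n, μ⟩ = n := rfl
  rw [hsz] at hdef hb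
  obtain ⟨U, k, hk, hU, hxU⟩ := terminal_form hx (fun ⟨δ, hδ⟩ => ht.2 δ hδ) (by
    rw [hdef]; exact_mod_cast hb)
  -- Cutting 1 U 2 before each 1 gives the blocks; the final 2 makes the last multiplicity nonzero.
  obtain ⟨a, ns, hw⟩ := exists_blockWord_of_head (b := 1) (w := 1 :: (U ++ [2])) (by
    intro c hc
    simp only [List.mem_cons, List.mem_append, List.not_mem_nil, or_false] at hc
    rcases hc with rfl | hc | rfl
    · exact .inl rfl
    · have := hU c hc; omega
    · exact .inr (by norm_num)) rfl
  have hl : LastNonzero (a :: ns) := lastNonzero_of_blockWord (b := 1) (by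
    rw [← hw, getLast?_cons_concat]; simp [eq_comm])
  have hl' : LastNonzero ns := by
    intro m hm
    exact hl m (by rw [List.getLast?_cons, hm]; rfl)
  obtain ⟨ν, rfl⟩ := exists_mults_eq hl'
  have e : 0 :: x = blockVec a ν.mults (List.replicate k 1) := by
    rw [hxU, blockVec, ← hw]; simp
  rw [e] at hdef hb ht
  rw [defu_of_nonneg fun _ => nonneg_of_mem_blockVec] at hdef
  have hd := defc_blockVec a ν.mults k
  rw [hdef, ← size_eq_weight, length_blockVec] at hd
  rw [minTri_blockVec] at hb
  refine ⟨ν, k, hk, by omega, ?_⟩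
  rw [flagVec]
  convert ht using 3
  omega

theorem flagVec_inj {n k k' : ℕ} {ν ν' : IntPartition} (hk : k ≤ 1) (hk' : k' ≤ 1)
    (h : 2 * ν.size + 4 ≤ n) (h' : 2 * ν'.size + 4 ≤ n)
    (e : ofQDV (flagVec n ν k) = ofQDV (flagVec n ν' k')) : ν = ν' ∧ k = k' := by
  have h1 := flagVec_bound hk h
  have h2 := flagVec_bound hk' h'
  have := blockVec_inj (LastNonzero.cons (by omega) (lastNonzero_mults ν))
    (LastNonzero.cons (by omega) (lastNonzero_mults ν')) e
  exact ⟨mults_injective this.1, this.2⟩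

/-! ### Counting -/

/-- The truncated bound j < (n - 2)/2 is equivalent to 2j + 4 ≤ n, and the two values of k account
for the factor 2. -/
theorem card_flagpole (n : ℕ) : Nat.card {μ : n.Partition // IsFlagpole ⟨n, μ⟩} =
    ∑ j ∈ Finset.range ((n - 2) / 2), 2 * Fintype.card j.Partition := by
  have hT : Nat.card (Σ j : Fin ((n - 2) / 2), Nat.Partition j × Fin 2) =
      ∑ j ∈ Finset.range ((n - 2) / 2), 2 * Fintype.card j.Partition := by
    rw [Nat.card_eq_fintype_card, Fintype.card_sigma,
      ← Fin.sum_univ_eq_sum_range (fun j => 2 * Fintype.card j.Partition)]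
    refine Finset.sum_congr rfl fun j _ => ?_
    rw [Fintype.card_prod, Fintype.card_fin, mul_comm]
  rw [← hT]
  have hsz : ∀ t : (Σ j : Fin ((n - 2) / 2), Nat.Partition j × Fin 2),
      2 * IntPartition.size ⟨t.1, t.2.1⟩ + 4 ≤ n := by
    intro t
    have := t.1.2
    show 2 * (t.1 : ℕ) + 4 ≤ n
    omega
  have hk : ∀ t : (Σ j : Fin ((n - 2) / 2), Nat.Partition j × Fin 2), (t.2.2 : ℕ) ≤ 1 := fun t =>
    Nat.le_of_lt_succ t.2.2.2
  choose f hf1 hf2 using fun t => exists_isTailInit2_flagVec (hk t) (hsz t)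
  symm
  refine Nat.card_eq_of_bijective (fun t => ⟨f t, hf1 t⟩) ⟨?_, ?_⟩
  · intro t t' htt
    have e : f t = f t' := congrArg Subtype.val htt
    have h1 := hf2 t
    rw [e] at h1
    obtain ⟨h2, h3⟩ := flagVec_inj (hk t) (hk t') (hsz t) (hsz t') (h1.unique (hf2 t'))
    obtain ⟨⟨j, hj⟩, p, i⟩ := t
    obtain ⟨⟨j', hj'⟩, p', i'⟩ := t'
    obtain rfl : i = i' := Fin.ext h3
    cases h2
    rfl
  · rintro ⟨μ, hμ⟩
    obtain ⟨⟨j, p⟩, k, hk1, hj, ht⟩ := exists_flagVec hμ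
    have hj' : j < (n - 2) / 2 := by
      have : 2 * j + 4 ≤ n := hj
      omega
    refine ⟨⟨⟨j, hj'⟩, p, ⟨k, by omega⟩⟩, Subtype.ext ?_⟩
    have hpos : ∀ q : n.Partition, 0 < IntPartition.size ⟨n, q⟩ := fun q => by
      show 0 < n
      omega
    have := eq_of_common_reflTransGen (hpos _) (hpos _) (hf2 ⟨⟨j, hj'⟩, p, ⟨k, by omega⟩⟩).1 ht.1
    cases this
    rfl

/-- For n < 4 the floor is negative and the integer interval empty, in agreement with the truncated
range. -/
theorem sum_Icc_eq_sum_range (n : ℕ) (f : ℕ → ℕ) :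
    ∑ j ∈ Finset.Icc (0 : ℤ) ⌊((n : ℚ) - 4) / 2⌋, f j.toNat =
      ∑ j ∈ Finset.range ((n - 2) / 2), f j := by
  have hm : ∀ j : ℕ, (j : ℤ) ≤ ⌊((n : ℚ) - 4) / 2⌋ ↔ j < (n - 2) / 2 := by
    intro j
    rw [Int.le_floor, le_div_iff₀ two_pos, le_sub_iff_add_le]
    push_cast
    have : (j : ℚ) * 2 + 4 ≤ n ↔ j * 2 + 4 ≤ n := by exact_mod_cast Iff.rfl
    rw [this]
    omega
  refine Finset.sum_nbij' Int.toNat Nat.cast ?_ ?_ ?_ ?_ ?_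
  · intro j hj
    obtain ⟨h0, h1⟩ := Finset.mem_Icc.1 hj
    lift j to ℕ using h0
    exact Finset.mem_range.2 ((hm j).1 h1)
  · intro j hj
    exact Finset.mem_Icc.2 ⟨Int.natCast_nonneg j, (hm j).2 (Finset.mem_range.1 hj)⟩
  · intro j hj
    exact Int.toNat_of_nonneg (Finset.mem_Icc.1 hj).1
  · intro j _
    exact Int.toNat_natCast j
  · intro j _
    rfl

end Flagpole

theorem mainTheorem8 (n : ℕ) :
    Nat.card {μ : n.Partition // Flagpole.IsFlagpole ⟨n, μ⟩} =
      ∑ j ∈ Finset.Icc (0 : ℤ) ⌊((n : ℚ) - 4) / 2⌋, 2 * Fintype.card (Nat.Partition j.toNat) := by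
  rw [Flagpole.card_flagpole,
    Flagpole.sum_Icc_eq_sum_range n fun j => 2 * Fintype.card (Nat.Partition j)]
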